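/- Let $p\in(0,1)$, let $q\ge 1$ and $\ell\ge 0$ be integers, and let $G=(V,E)$ be a finite simple graph with at least one edge. For $A\subseteq E$ let $c(A)$ be the number of connected components of $(V,A)$ (isolated vertices included), and let $\mu(A)=Z^{-1}\left(\frac{p}{1-p}\right)^{|A|}q^{c(A)}$, with $Z$ the normalizing constant, be the random-cluster measure on subsets of $E$. For $\sigma:V\to\{1,\dots,q\}$ let $E(\sigma)$ be the set of edges whose two ends have the same colour under $\sigma$. The Swendsen-Wang dynamics and the lazy single-bond dynamics on the subsets of $E$ are the Markov chains with transition matrices $$P_{\rm SW}(A,B)=q^{-c(A)}\left(\frac{p}{1-p}\right)^{|B|}\sum_{\sigma:\,A\cup B\subseteq E(\sigma)}(1-p)^{|E(\sigma)|},\qquad P_{\rm SB}(A,B)=\frac{\mathbf 1(A=B)}{2}+\frac1{2|E|}\sum_{e\in E}P_e(A,B),$$ where $P_e(A,B)=\mathbf 1(A\ominus B\subseteq\{e\})\,r^{|B\cap\{e\}|}(1-r)^{1-|B\cap\{e\}|}$, $\ominus$ denotes the symmetric difference, and $r=p$ if the two ends of $e$ are connected in $(V,A)$, $r=p/q$ otherwise.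 The spectral gap of such a chain is $\lambda(P)=1-\max\{|\xi|:\xi\text{ is an eigenvalue of }P,\ \xi\ne1\}$. The linear-width of $G$ is the smallest number $k$ such that the edges can be ordered $e_1,\dots,e_{|E|}$ so that for every $i$ at most $k$ vertices are incident both to an edge of $\{e_1,\dots,e_i\}$ and to an edge of $\{e_{i+1},\dots,e_{|E|}\}$. If the linear-width of $G$ is at most $\ell$, then $\lambda(P_{\rm SW})$ and $\lambda(P_{\rm SB})$ are positive and $$\lambda(P_{\rm SW})^{-1}\;\le\;\lambda(P_{\rm SB})^{-1}\;\le\;4|E|^2q^{\ell+1}.$$ Consequently both dynamics are rapidly mixing for graphs of bounded linear-width: for fixed $p,q,\ell$ and every family $(G_i)_i$ of finite simple graphs with at least one edge and linear-width at most $\ell$, there are constants $C,K$ such that for all $i$ the mixing times of both dynamics on $G_i$ are at most $K\,(\log|\Omega_i|)^{C}$. Here $\Omega_i$ is the set of all subsets of the edge set of $G_i$, and the mixing time is the least $t$ with $\max_{x}\sum_{y}|P^t(x,y)-\mu(y)|\le 1/e$. -/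

import Mathlib

open scoped symmDiff

noncomputable section

namespace MarkovChain

variable {Ω : Type*} [Fintype Ω] [DecidableEq Ω]

/-- The (absolute) spectral gap `1 - max {|ξ| : ξ an eigenvalue of P, ξ ≠ 1}` of a transition
matrix. The eigenvalues are real for the reversible chains considered here. -/
def spectralGap (P : Matrix Ω Ω ℝ) : ℝ :=
  1 - sSup ((fun ξ : ℝ => |ξ|) ''
    {ξ : ℝ | Module.End.HasEigenvalue (Matrix.toLin' P) ξ ∧ ξ ≠ 1})

/-- The mixing time of `P` with stationary distribution `π`: the least `t` such that
`∑ y, |P ^ t (x, y) - π y| ≤ 1 / e` for all `x` (it is `⊤` if there is no such `t`). -/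
def mixingTime (P : Matrix Ω Ω ℝ) (π : Ω → ℝ) : ℕ∞ :=
  ⨅ (t : ℕ) (_ : ∀ x, ∑ y, |(P ^ t) x y - π y| ≤ 1 / Real.exp 1), (t : ℕ∞)

/-- A family of chains is rapidly mixing if the mixing times are finite and bounded by a constant
times a power of the logarithm of the size of the state space, uniformly in the family. -/
def RapidlyMixing {ι : Type*} {S : ι → Type*} [∀ i, Fintype (S i)] [∀ i, DecidableEq (S i)]
    (P : ∀ i, Matrix (S i) (S i) ℝ) (π : ∀ i, S i → ℝ) : Prop :=
  ∃ C K : ℝ, ∀ i, ∃ t : ℕ, mixingTime (P i) (π i) = (t : ℕ∞) ∧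
    (t : ℝ) ≤ K * Real.log (Fintype.card (S i)) ^ C

end MarkovChain

namespace RandomCluster

variable {V : Type*} (G : SimpleGraph V)

/-- The linear-width of a finite graph: the least `ℓ` such that for some ordering of the edges,
for every `i` at most `ℓ` vertices are incident both to one of the edges up to the `i`-th one and
to one of the later edges. -/
def linearWidth [Fintype G.edgeSet] : ℕ :=
  sInf {ℓ : ℕ | ∃ e : Fin (Fintype.card G.edgeSet) ≃ G.edgeSet,
    ∀ i, {v : V | (∃ j, j ≤ i ∧ v ∈ (e j : Sym2 V)) ∧
      ∃ j, i < j ∧ v ∈ (e j : Sym2 V)}.ncard ≤ ℓ}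

variable {G}

/-- The spanning subgraph `(V, A)` of `G`, for a set `A` of edges. -/
def subgraphOf (A : Finset G.edgeSet) : SimpleGraph V :=
  SimpleGraph.fromEdgeSet ((fun e : G.edgeSet => (e : Sym2 V)) '' (A : Set G.edgeSet))

/-- The number of connected components of `(V, A)`, isolated vertices included. -/
def numComponents (A : Finset G.edgeSet) : ℕ :=
  Nat.card (subgraphOf A).ConnectedComponent

/-- The two ends of the edge `e` are connected in `(V, A)`. -/
def EndsConnected (A : Finset G.edgeSet) (e : G.edgeSet) : Prop :=
  ∀ u ∈ (e : Sym2 V), ∀ v ∈ (e : Sym2 V), (subgraphOf A).Reachable u v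

/-- The two ends of the edge `e` have the same colour under `σ`. -/
def Monochromatic {q : ℕ} (σ : V → Fin q) (e : G.edgeSet) : Prop :=
  ∀ u ∈ (e : Sym2 V), ∀ v ∈ (e : Sym2 V), σ u = σ v

variable (G) in
open Classical in
/-- The set `E(σ)` of the monochromatic edges of the colouring `σ`. -/
def monochromaticEdges [Fintype G.edgeSet] {q : ℕ} (σ : V → Fin q) : Finset G.edgeSet :=
  Finset.univ.filter fun e => Monochromatic σ e

/-- The unnormalised random-cluster weight of `A`. -/
def weight (p : ℝ) (q : ℕ) (A : Finset G.edgeSet) : ℝ :=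
  (p / (1 - p)) ^ A.card * (q : ℝ) ^ numComponents A

variable (G) in
/-- The random-cluster measure (as a probability mass function on the sets of edges). -/
def measure [Fintype G.edgeSet] (p : ℝ) (q : ℕ) (A : Finset G.edgeSet) : ℝ :=
  weight p q A / ∑ B : Finset G.edgeSet, weight p q B

variable (G) in
open Classical in
/-- The transition matrix of the Swendsen-Wang dynamics on the random-cluster model. -/
def swendsenWang [Fintype V] [Fintype G.edgeSet] (p : ℝ) (q : ℕ) :
    Matrix (Finset G.edgeSet) (Finset G.edgeSet) ℝ :=
  Matrix.of fun A B =>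
    ((q : ℝ) ^ numComponents A)⁻¹ * (p / (1 - p)) ^ B.card *
      ∑ σ : V → Fin q, (1 - p) ^ (monochromaticEdges G σ).card *
        (if ∀ e ∈ A ∪ B, Monochromatic σ e then 1 else 0)

open Classical in
/-- The probability of the edge `e` being present after it has been updated in the state `A`. -/
def updateProb (p : ℝ) (q : ℕ) (A : Finset G.edgeSet) (e : G.edgeSet) : ℝ :=
  if EndsConnected A e then p else p / q

open Classical in
/-- The transition matrix of the update of the single edge `e`. -/
def edgeUpdate (p : ℝ) (q : ℕ) (e : G.edgeSet) :
    Matrix (Finset G.edgeSet) (Finset G.edgeSet) ℝ :=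
  Matrix.of fun A B =>
    if A ∆ B ⊆ {e} then
      updateProb p q A e ^ (B ∩ {e}).card * (1 - updateProb p q A e) ^ (1 - (B ∩ {e}).card)
    else 0

variable (G) in
open Classical in
/-- The transition matrix of the lazy single-bond dynamics. -/
def singleBond [Fintype G.edgeSet] (p : ℝ) (q : ℕ) :
    Matrix (Finset G.edgeSet) (Finset G.edgeSet) ℝ :=
  (1 / 2 : ℝ) • (1 : Matrix (Finset G.edgeSet) (Finset G.edgeSet) ℝ) +
    (1 / (2 * (Fintype.card G.edgeSet : ℝ))) • ∑ e : G.edgeSet, edgeUpdate p q e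

end RandomCluster

end

/-! Both chains are self-adjoint for the inner product weighted by the random-cluster measure, so
everything is done with quadratic forms.

Comparison of the chains. Couple the edge set with a random colouring (the Edwards-Sokal coupling).
Given the colouring, Swendsen-Wang redraws all edges, while the update of `e` redraws only `e`. By
Cauchy-Schwarz the former has the smaller quadratic form (`swendsenWang_form_le_edgeUpdate_form`),
hence Swendsen-Wang is dominated by single-bond. Its form is a sum of squares, so both chains are
positive semidefinite, and domination of forms orders the gaps without loss
(`spectralGap_le_of_form_le`).

Lower bound for the single-bond gap. Join `A` to `B` by the path that gives each edge its status in
`B`, in an order realising the linear-width. When the edges in `L` are done, the path is at `Z = mix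
L A B`, and `W = mix L B A` is the complementary state; the pair `(Z, W)` determines `(A, B)`. The
weights satisfy w(A) w(B) ≤ q^ℓ w(Z) w(W) (`weight_mul_weight_le`). Indeed q^c(A) is the order of
the group of colourings constant along the edges of `A`, and two colourings that agree on the
boundary of `L` can be exchanged on one side of it (`pow_numComponents_mul_le`). Summing over all
paths yields `poincareBound_singleBond`.

Mixing. A Poincaré bound for a positive semidefinite chain gives geometric decay in the weighted ℓ²
norm. The starting cost log(1/μ(A)) and log|Ω| are both at most linear in the number of edges, so
polynomial bounds in |E| suffice. -/

namespace MarkovChain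

/-! ### Spectral gap, quadratic forms and convergence of reversible chains -/

open Matrix

variable {Ω : Type*} [Fintype Ω]

/-- `P` is a stochastic matrix that is self-adjoint and positive semidefinite with respect to the
inner product with the positive weights `w`. -/
structure IsReversiblePSD (P : Matrix Ω Ω ℝ) (w : Ω → ℝ) : Prop where
  pos : ∀ x, 0 < w x
  mulVec_one : P *ᵥ 1 = 1
  symm : ∀ f g : Ω → ℝ, ∑ x, w x * (f x * (P *ᵥ g) x) = ∑ x, w x * (g x * (P *ᵥ f) x)
  nonneg : ∀ f : Ω → ℝ, 0 ≤ ∑ x, w x * (f x * (P *ᵥ f) x)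

/-- The Rayleigh quotients of `P` on the functions of mean zero are at most `β`. -/
def PoincareBound (P : Matrix Ω Ω ℝ) (w : Ω → ℝ) (β : ℝ) : Prop :=
  ∀ f : Ω → ℝ, ∑ x, w x * f x = 0 →
    ∑ x, w x * (f x * (P *ᵥ f) x) ≤ β * ∑ x, w x * f x ^ 2

namespace IsReversiblePSD

variable {P : Matrix Ω Ω ℝ} {w : Ω → ℝ} {β : ℝ}

theorem sum_mulVec (h : IsReversiblePSD P w) (f : Ω → ℝ) :
    ∑ x, w x * (P *ᵥ f) x = ∑ x, w x * f x := by
  have := h.symm 1 f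
  simpa [h.mulVec_one] using this

theorem sum_sq_pos (h : IsReversiblePSD P w) {f : Ω → ℝ} (hf : f ≠ 0) :
    0 < ∑ x, w x * f x ^ 2 := by
  obtain ⟨x, hx⟩ := Function.ne_iff.1 hf
  refine Finset.sum_pos' (fun y _ => mul_nonneg (h.pos y).le (sq_nonneg _)) ⟨x, Finset.mem_univ _, ?_⟩
  have : f x ≠ 0 := hx
  have := h.pos x
  positivity

/-- Since `P` preserves means, an eigenvector for `ξ ≠ 1` has mean zero, and its Rayleigh quotient
is `ξ`. Positivity makes the absolute value in `spectralGap` harmless. -/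
theorem eigenvalue_mem [DecidableEq Ω] (h : IsReversiblePSD P w) (hβ : PoincareBound P w β) {ξ : ℝ}
    (hξ : Module.End.HasEigenvalue (Matrix.toLin' P) ξ) (h1 : ξ ≠ 1) : 0 ≤ ξ ∧ ξ ≤ β := by
  obtain ⟨f, hf⟩ := hξ.exists_hasEigenvector
  have hPf : P *ᵥ f = ξ • f := by simpa using hf.apply_eq_smul
  have h0 := h.sum_sq_pos hf.2
  have hsum : ∑ x, w x * f x = 0 := by
    have := h.sum_mulVec f
    rw [hPf] at this
    have e : ∑ x, w x * (ξ • f) x = ξ * ∑ x, w x * f x := by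
      rw [Finset.mul_sum]; exact Finset.sum_congr rfl fun x _ => by simp; ring
    rw [e] at this
    have : (ξ - 1) * ∑ x, w x * f x = 0 := by linarith
    exact (mul_eq_zero.1 this).resolve_left (sub_ne_zero.2 h1)
  have e : ∑ x, w x * (f x * (P *ᵥ f) x) = ξ * ∑ x, w x * f x ^ 2 := by
    rw [hPf, Finset.mul_sum]; exact Finset.sum_congr rfl fun x _ => by simp; ring
  have h2 := h.nonneg f
  have h3 := hβ f hsum
  rw [e] at h2 h3
  exact ⟨nonneg_of_mul_nonneg_left h2 h0, le_of_mul_le_mul_right h3 h0⟩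

theorem one_sub_le_spectralGap [DecidableEq Ω] (h : IsReversiblePSD P w) (hβ : PoincareBound P w β) (h0 : 0 ≤ β) :
    1 - β ≤ spectralGap P := by
  -- `0 ≤ β` covers the case of no eigenvalue other than 1, where the supremum is `sSup ∅ = 0`.
  refine sub_le_sub_left (Real.sSup_le ?_ h0) 1
  rintro _ ⟨ξ, ⟨h1, h2⟩, rfl⟩
  have := h.eigenvalue_mem hβ h1 h2
  simpa [abs_of_nonneg this.1] using this.2

theorem le_one_sub_spectralGap [DecidableEq Ω] {P : Matrix Ω Ω ℝ} {ξ : ℝ}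
    (hξ : Module.End.HasEigenvalue (Matrix.toLin' P) ξ) (h1 : ξ ≠ 1) :
    ξ ≤ 1 - spectralGap P := by
  have hfin : {ξ : ℝ | Module.End.HasEigenvalue (Matrix.toLin' P) ξ ∧ ξ ≠ 1}.Finite :=
    (Module.End.finite_hasEigenvalue (Matrix.toLin' P)).subset fun _ h => h.1
  have := le_csSup (hfin.image fun ξ : ℝ => |ξ|).bddAbove ⟨ξ, ⟨hξ, h1⟩, rfl⟩
  have h2 := le_abs_self ξ
  unfold spectralGap
  simp only at this
  linarith

/-- Simplicity of the eigenvalue 1: a fixed function minus its mean has Rayleigh quotient 1 unless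
it vanishes. -/
theorem eq_const_of_mulVec_eq (h : IsReversiblePSD P w) (hβ : PoincareBound P w β) (h1 : β < 1)
    {f : Ω → ℝ} (hf : P *ᵥ f = f) : ∃ c : ℝ, f = fun _ => c := by
  rcases isEmpty_or_nonempty Ω with hΩ | hΩ
  · exact ⟨0, funext fun x => hΩ.elim x⟩
  have hW : 0 < ∑ x, w x := Finset.sum_pos (fun x _ => h.pos x) Finset.univ_nonempty
  set c := (∑ x, w x * f x) / ∑ x, w x with hc
  refine ⟨c, ?_⟩
  set g : Ω → ℝ := f - c • 1 with hg
  have hPg : P *ᵥ g = g := by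
    rw [hg, Matrix.mulVec_sub, Matrix.mulVec_smul, h.mulVec_one, hf]
  have hs : ∑ x, w x * g x = 0 := by
    have : ∑ x, w x * g x = ∑ x, w x * f x - c * ∑ x, w x := by
      rw [Finset.mul_sum, ← Finset.sum_sub_distrib]
      exact Finset.sum_congr rfl fun x _ => by simp [hg]; ring
    rw [this, hc]; field_simp; ring
  have hg0 : g = 0 := by
    by_contra hne
    have h2 := h.sum_sq_pos hne
    have h3 := hβ g hs
    rw [hPg] at h3
    have e : ∑ x, w x * (g x * g x) = ∑ x, w x * g x ^ 2 :=
      Finset.sum_congr rfl fun x _ => by ring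
    rw [e] at h3
    nlinarith
  funext x
  have := congrFun hg0 x
  simp [hg] at this
  linarith

theorem detailed_balance (h : IsReversiblePSD P w) (x y : Ω) : w x * P x y = w y * P y x := by
  classical
  have := h.symm (Pi.single x 1) (Pi.single y 1)
  simpa [Pi.single_apply] using this

/-- The spectral gap controls all Rayleigh quotients on functions of mean zero. -/
theorem poincareBound_spectralGap [DecidableEq Ω] (h : IsReversiblePSD P w) (hβ : PoincareBound P w β)
    (h1 : β < 1) : PoincareBound P w (1 - spectralGap P) := by
  intro f hf
  set s : Ω → ℝ := fun x => √(w x) with hs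
  have s0 : ∀ x, s x ≠ 0 := fun x => (Real.sqrt_pos.2 (h.pos x)).ne'
  have s2 : ∀ x, s x * s x = w x := fun x => Real.mul_self_sqrt (h.pos x).le
  -- Conjugation by the square root of the weights turns detailed balance into symmetry, so the
  -- spectral theorem applies. Eigenvectors `u i` of `S` correspond to eigenfunctions `u i / s` of
  -- `P`.
  set S : Matrix Ω Ω ℝ := Matrix.of fun x y => s x * P x y / s y with hSdef
  have hS : S.IsHermitian := by
    ext x y
    have := h.detailed_balance x y
    rw [← s2, ← s2] at this
    simp only [hSdef, Matrix.conjTranspose_apply, Matrix.of_apply, star_trivial]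
    rw [div_eq_div_iff (s0 x) (s0 y)]
    linarith
  have hSmul : ∀ g : Ω → ℝ, S *ᵥ g = fun x => s x * (P *ᵥ fun y => g y / s y) x := by
    intro g; funext x
    simp only [Matrix.mulVec, dotProduct, hSdef, Matrix.of_apply, Finset.mul_sum]
    exact Finset.sum_congr rfl fun y _ => by ring
  set b := hS.eigenvectorBasis
  set u : Ω → Ω → ℝ := fun i => ⇑(b i) with hu
  have hSu : ∀ i, S *ᵥ u i = hS.eigenvalues i • u i := fun i => hS.mulVec_eigenvectorBasis i
  have hPu : ∀ i, P *ᵥ (fun y => u i y / s y) = hS.eigenvalues i • fun y => u i y / s y := by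
    intro i; funext x
    have := congrFun (hSu i) x
    rw [hSmul] at this
    simp only [Pi.smul_apply, smul_eq_mul] at this ⊢
    have hx := s0 x
    field_simp
    linarith
  have hinner : ∀ v z : EuclideanSpace ℝ Ω, inner ℝ v z = ∑ x, v x * z x := by
    intro v z
    simp [PiLp.inner_apply, mul_comm]
  set g : EuclideanSpace ℝ Ω := WithLp.toLp 2 fun x => s x * f x with hg
  set Sg : EuclideanSpace ℝ Ω := WithLp.toLp 2 (S *ᵥ fun x => s x * f x) with hSg
  have e1 : ∑ x, w x * f x ^ 2 = ∑ i, (inner ℝ (b i) g) ^ 2 := by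
    have := b.sum_sq_norm_inner_right g
    simp only [Real.norm_eq_abs, sq_abs] at this
    rw [this, ← real_inner_self_eq_norm_sq, hinner]
    exact Finset.sum_congr rfl fun x _ => by simp [hg, ← s2]; ring
  have e2 : ∀ i, inner ℝ (b i) Sg = hS.eigenvalues i * inner ℝ (b i) g := by
    intro i
    have t1 : inner ℝ (b i) Sg = u i ⬝ᵥ (S *ᵥ fun x => s x * f x) := hinner _ _
    have t2 : inner ℝ (b i) g = u i ⬝ᵥ (fun x => s x * f x) := hinner _ _
    have hT : Sᵀ = S := by rw [← Matrix.conjTranspose_eq_transpose_of_trivial, hS.eq]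
    rw [t1, t2, Matrix.dotProduct_mulVec, ← Matrix.mulVec_transpose, hT, hSu, smul_dotProduct,
      smul_eq_mul]
  have e3 : ∑ x, w x * (f x * (P *ᵥ f) x) = ∑ i, hS.eigenvalues i * (inner ℝ (b i) g) ^ 2 := by
    have t1 : ∑ x, w x * (f x * (P *ᵥ f) x) = inner ℝ g Sg := by
      rw [hinner]
      refine Finset.sum_congr rfl fun x _ => ?_
      simp only [hg, hSg, hSmul]
      have : (fun y => s y * f y / s y) = f := funext fun y => by
        have := s0 y; field_simp
      rw [this, ← s2]; ring
    rw [t1, ← b.sum_inner_mul_inner g Sg]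
    refine Finset.sum_congr rfl fun i _ => ?_
    rw [e2, real_inner_comm]; ring
  rw [e1, e3, Finset.mul_sum]
  refine Finset.sum_le_sum fun i _ => ?_
  have hui : (fun y => u i y / s y) ≠ 0 := by
    intro h0
    have : b i = 0 := by
      ext y
      have := congrFun h0 y
      simpa [s0 y, hu] using this
    have hn := b.orthonormal.1 i
    simp [this] at hn
  -- In the expansion of the form over eigenvectors, those of eigenvalue 1 come from constants and
  -- do not see `f`, which has mean zero; every other eigenvalue is bounded by the gap.
  by_cases hi : hS.eigenvalues i = 1
  · have : P *ᵥ (fun y => u i y / s y) = fun y => u i y / s y := by rw [hPu, hi, one_smul]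
    obtain ⟨c, hc⟩ := h.eq_const_of_mulVec_eq hβ h1 this
    have : inner ℝ (b i) g = 0 := by
      rw [hinner, ← mul_zero c, ← hf, Finset.mul_sum]
      refine Finset.sum_congr rfl fun x _ => ?_
      have hx := congrFun hc x
      have hx' : (b i) x = c * s x := by
        have := s0 x
        have h3 : u i x / s x = c := hx
        field_simp at h3
        rw [mul_comm]
        exact h3
      rw [hx', ← s2]; simp [hg]; ring
    rw [this]; simp
  · refine mul_le_mul_of_nonneg_right (le_one_sub_spectralGap ?_ hi) (sq_nonneg _)
    refine Module.End.hasEigenvalue_of_hasEigenvector (x := fun y => u i y / s y) ⟨?_, hui⟩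
    rw [Module.End.mem_eigenspace_iff]
    simpa using hPu i

/-- If `P` is dominated by `Q` as a quadratic form, its spectral gap is at least that of `Q`. -/
theorem spectralGap_le_of_form_le [DecidableEq Ω] {Q : Matrix Ω Ω ℝ} (hP : IsReversiblePSD P w)
    (hQ : IsReversiblePSD Q w) (hβ : PoincareBound Q w β) (h1 : β < 1)
    (hPQ : ∀ f : Ω → ℝ, ∑ x, w x * (f x * (P *ᵥ f) x) ≤ ∑ x, w x * (f x * (Q *ᵥ f) x)) :
    spectralGap Q ≤ spectralGap P := by
  have hQ' := hQ.poincareBound_spectralGap hβ h1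
  have h0 : 0 ≤ 1 - spectralGap Q := by
    unfold spectralGap
    rw [sub_sub_cancel]
    refine Real.sSup_nonneg ?_
    rintro _ ⟨ξ, -, rfl⟩
    exact abs_nonneg ξ
  have := hP.one_sub_le_spectralGap (β := 1 - spectralGap Q)
    (fun f hf => (hPQ f).trans (hQ' f hf)) h0
  linarith

/-- Cauchy-Schwarz for the semidefinite form ⟨f, Pg⟩ at `g = P *ᵥ f` gives ‖Pf‖⁴ ≤ ⟨f, Pf⟩⟨g, Pg⟩,
and the Poincaré bound applies to both factors. It is proved by the discriminant of the form at `t •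
f + g`. -/
theorem sum_mulVec_sq_le (h : IsReversiblePSD P w) (hβ : PoincareBound P w β)
    {f : Ω → ℝ} (hf : ∑ x, w x * f x = 0) :
    ∑ x, w x * (P *ᵥ f) x ^ 2 ≤ β ^ 2 * ∑ x, w x * f x ^ 2 := by
  set g := P *ᵥ f with hg
  have hg0 : ∑ x, w x * g x = 0 := by rw [hg, h.sum_mulVec, hf]
  have hf1 := hβ f hf
  have hg1 := hβ g hg0
  set a := ∑ x, w x * (f x * (P *ᵥ f) x)
  set c := ∑ x, w x * (g x * (P *ᵥ g) x)
  set d := ∑ x, w x * g x ^ 2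
  set F := ∑ x, w x * f x ^ 2
  have ha : 0 ≤ a := h.nonneg f
  have hc : 0 ≤ c := h.nonneg g
  have hd : 0 ≤ d := Finset.sum_nonneg fun x _ => mul_nonneg (h.pos x).le (sq_nonneg _)
  have hF : 0 ≤ F := Finset.sum_nonneg fun x _ => mul_nonneg (h.pos x).le (sq_nonneg _)
  have key : ∀ t : ℝ, 0 ≤ a * (t * t) + (2 * d) * t + c := by
    intro t
    have := h.nonneg (t • f + g)
    have e : ∑ x, w x * ((t • f + g) x * (P *ᵥ (t • f + g)) x)
        = a * (t * t) + t * ∑ x, w x * (f x * (P *ᵥ g) x) + d * t + c := by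
      simp only [a, c, d, Finset.mul_sum, Finset.sum_mul, ← Finset.sum_add_distrib]
      refine Finset.sum_congr rfl fun x _ => ?_
      rw [Matrix.mulVec_add, Matrix.mulVec_smul, ← hg]
      simp only [Pi.add_apply, Pi.smul_apply, smul_eq_mul]
      ring
    have e2 : ∑ x, w x * (f x * (P *ᵥ g) x) = d := by
      rw [h.symm f g]
      exact Finset.sum_congr rfl fun x _ => by rw [← hg]; ring
    rw [e, e2] at this
    linarith
  have hdisc := discrim_le_zero key
  rw [discrim] at hdisc
  have hac : d * d ≤ a * c := by nlinarith
  rcases hd.eq_or_lt with hd0 | hd0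
  · rw [← hd0]; positivity
  have h4 : a * c ≤ (β * F) * (β * d) := mul_le_mul hf1 hg1 hc (ha.trans hf1)
  have : d * d ≤ (β ^ 2 * F) * d := by linarith [show (β * F) * (β * d) = (β ^ 2 * F) * d by ring]
  exact le_of_mul_le_mul_right this hd0

theorem sum_pow_mulVec_sq_le [DecidableEq Ω] (h : IsReversiblePSD P w) (hβ : PoincareBound P w β)
    {f : Ω → ℝ} (hf : ∑ x, w x * f x = 0) (t : ℕ) :
    ∑ x, w x * (P ^ t *ᵥ f) x = 0 ∧
      ∑ x, w x * (P ^ t *ᵥ f) x ^ 2 ≤ β ^ (2 * t) * ∑ x, w x * f x ^ 2 := by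
  induction t with
  | zero => simpa using hf
  | succ t ih =>
    rw [pow_succ' P t, ← Matrix.mulVec_mulVec]
    refine ⟨by rw [h.sum_mulVec, ih.1], (h.sum_mulVec_sq_le hβ ih.1).trans ?_⟩
    have := mul_le_mul_of_nonneg_left ih.2 (sq_nonneg β)
    refine this.trans (le_of_eq ?_)
    ring

theorem pow_mulVec_one [DecidableEq Ω] (h : IsReversiblePSD P w) (t : ℕ) : P ^ t *ᵥ 1 = 1 := by
  induction t with
  | zero => simp
  | succ t ih => rw [pow_succ, ← Matrix.mulVec_mulVec, h.mulVec_one, ih]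

/-- By duality the ℓ¹ distance is the value at `x` of `P ^ t` applied to a sign function, centred to
have mean zero. The value at one point is controlled by the weighted ℓ² norm, at the price of
dividing by `w x`. -/
theorem sum_abs_pow_sub_le [DecidableEq Ω] (h : IsReversiblePSD P w) (hβ : PoincareBound P w β) (h0 : 0 ≤ β)
    (t : ℕ) (x : Ω) :
    ∑ y, |(P ^ t) x y - w y / ∑ z, w z| ≤ β ^ t * √((∑ z, w z) / w x) := by
  set W := ∑ z, w z with hWdef
  have hW : 0 < W := Finset.sum_pos (fun x _ => h.pos x) ⟨x, Finset.mem_univ x⟩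
  set g : Ω → ℝ := fun y => SignType.sign ((P ^ t) x y - w y / W) with hg
  have hg1 : ∀ y, g y ^ 2 ≤ 1 := by
    intro y
    rcases lt_trichotomy ((P ^ t) x y - w y / W) 0 with hy | hy | hy <;> simp [hg, hy]
  set c := (∑ y, w y * g y) / W with hc
  have hcW : ∑ y, w y * g y = c * W := by rw [hc]; field_simp
  set f : Ω → ℝ := g - c • 1 with hf
  have hf0 : ∑ y, w y * f y = 0 := by
    have : ∑ y, w y * f y = ∑ y, w y * g y - c * W := by
      rw [hWdef, Finset.mul_sum, ← Finset.sum_sub_distrib]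
      exact Finset.sum_congr rfl fun y _ => by simp [hf]; ring
    rw [this, hcW, sub_self]
  have hf2 : ∑ y, w y * f y ^ 2 ≤ W := by
    have : ∑ y, w y * f y ^ 2 = ∑ y, w y * g y ^ 2 - 2 * c * ∑ y, w y * g y + c ^ 2 * W := by
      rw [hWdef, Finset.mul_sum, Finset.mul_sum, ← Finset.sum_sub_distrib,
        ← Finset.sum_add_distrib]
      exact Finset.sum_congr rfl fun y _ => by simp [hf]; ring
    rw [this, hcW]
    have h2 : ∑ y, w y * g y ^ 2 ≤ W :=
      Finset.sum_le_sum fun y _ => mul_le_of_le_one_right (h.pos y).le (hg1 y)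
    nlinarith [mul_nonneg (sq_nonneg c) hW.le]
  have hval : (P ^ t *ᵥ f) x = ∑ y, |(P ^ t) x y - w y / W| := by
    rw [hf, Matrix.mulVec_sub, Matrix.mulVec_smul, h.pow_mulVec_one]
    simp only [Pi.sub_apply, Pi.smul_apply, Pi.one_apply, smul_eq_mul, mul_one, Matrix.mulVec,
      dotProduct]
    rw [hc, Finset.sum_div, ← Finset.sum_sub_distrib]
    refine Finset.sum_congr rfl fun y _ => ?_
    rw [← self_mul_sign]
    simp only [hg]
    ring
  have hx : w x * (P ^ t *ᵥ f) x ^ 2 ≤ β ^ (2 * t) * W :=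
    (Finset.single_le_sum (f := fun x => w x * (P ^ t *ᵥ f) x ^ 2)
      (fun y _ => mul_nonneg (h.pos y).le (sq_nonneg _)) (Finset.mem_univ x)).trans
      (((h.sum_pow_mulVec_sq_le hβ hf0 t).2).trans
        (mul_le_mul_of_nonneg_left hf2 (by positivity)))
  rw [← hval]
  refine le_of_sq_le_sq ?_ (by positivity)
  rw [mul_pow, Real.sq_sqrt (div_nonneg hW.le (h.pos x).le), ← pow_mul, mul_comm t 2,
    ← mul_div_assoc, le_div_iff₀ (h.pos x)]
  linarith

end IsReversiblePSD

/-- Witness for the finiteness of the mixing time. -/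
theorem exists_mixingTime_eq [DecidableEq Ω] {P : Matrix Ω Ω ℝ} {π : Ω → ℝ} {t : ℕ}
    (ht : ∀ x, ∑ y, |(P ^ t) x y - π y| ≤ 1 / Real.exp 1) :
    ∃ s : ℕ, mixingTime P π = (s : ℕ∞) ∧ s ≤ t := by
  have hle : mixingTime P π ≤ (t : ℕ∞) := iInf₂_le t ht
  obtain ⟨s, hs⟩ := ENat.ne_top_iff_exists.1 (ne_top_of_le_ne_top (ENat.natCast_ne_top t) hle)
  exact ⟨s, hs.symm, by rw [← hs] at hle; exact_mod_cast hle⟩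

end MarkovChain

namespace RandomCluster

/-! ### Counting components by groups of colourings -/

section Colourings

variable {V : Type*} {G : SimpleGraph V} {q : ℕ}

theorem Monochromatic.apply_eq {σ : V → Fin q} {e : G.edgeSet} (h : Monochromatic σ e)
    {u v : V} (hu : u ∈ (e : Sym2 V)) (hv : v ∈ (e : Sym2 V)) : σ u = σ v := h u hu v hv

theorem subgraphOf_adj {A : Finset G.edgeSet} {u v : V} (e : G.edgeSet) (he : e ∈ A)
    (h : (e : Sym2 V) = s(u, v)) : (subgraphOf A).Adj u v := by
  have hadj : G.Adj u v := by
    have := e.2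
    rwa [h] at this
  rw [subgraphOf, SimpleGraph.fromEdgeSet_adj]
  exact ⟨⟨e, he, h⟩, hadj.ne⟩

theorem eq_of_reachable {A : Finset G.edgeSet} {σ : V → Fin q}
    (h : ∀ e ∈ A, Monochromatic σ e) {u v : V} (huv : (subgraphOf A).Reachable u v) :
    σ u = σ v := by
  obtain ⟨p⟩ := huv
  induction p with
  | nil => rfl
  | cons hadj _ ih =>
    rw [subgraphOf, SimpleGraph.fromEdgeSet_adj] at hadj
    obtain ⟨⟨e, he, h'⟩, -⟩ := hadj
    rw [← ih]
    refine (h e he).apply_eq ?_ ?_ <;> simp [h']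

theorem reachable_of_mem {A : Finset G.edgeSet} {e : G.edgeSet} (he : e ∈ A) {u v : V}
    (hu : u ∈ (e : Sym2 V)) (hv : v ∈ (e : Sym2 V)) : (subgraphOf A).Reachable u v := by
  by_cases huv : u = v
  · rw [huv]
  · exact (subgraphOf_adj e he ((Sym2.mem_and_mem_iff huv).1 ⟨hu, hv⟩)).reachable

theorem endsConnected_of_mem {A : Finset G.edgeSet} {e : G.edgeSet} (he : e ∈ A) :
    EndsConnected A e := fun _ hu _ hv => reachable_of_mem he hu hv

variable (q) in
/-- The group of the colourings (by the group `ℤ / q`) for which all edges of `A` are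
monochromatic. -/
def colourings [NeZero q] (A : Finset G.edgeSet) : AddSubgroup (V → Fin q) where
  carrier := {σ | ∀ e ∈ A, Monochromatic σ e}
  zero_mem' := fun _ _ _ _ _ _ => rfl
  add_mem' := fun hσ hτ e he u hu v hv => by
    simp only [Pi.add_apply]
    rw [hσ e he u hu v hv, hτ e he u hu v hv]
  neg_mem' := fun hσ e he u hu v hv => by
    simp only [Pi.neg_apply]
    rw [hσ e he u hu v hv]

theorem mem_colourings [NeZero q] {A : Finset G.edgeSet} {σ : V → Fin q} :
    σ ∈ colourings q A ↔ ∀ e ∈ A, Monochromatic σ e := Iff.rfl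

variable [Finite V]

/-- Such a colouring is a free choice of colour on each component. Component counts thereby become
group orders, to be compared through homomorphisms. -/
theorem card_colourings [NeZero q] (A : Finset G.edgeSet) :
    Nat.card (colourings q A) = q ^ numComponents A := by
  have e : colourings q A ≃ ((subgraphOf A).ConnectedComponent → Fin q) :=
    { toFun := fun σ c => c.lift (σ : V → Fin q)
        fun u v p _ => eq_of_reachable (mem_colourings.1 σ.2) ⟨p⟩
      invFun := fun τ => ⟨fun v => τ ((subgraphOf A).connectedComponentMk v),
        fun e he u hu v hv => congrArg τ
          (SimpleGraph.ConnectedComponent.sound (reachable_of_mem he hu hv))⟩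
      left_inv := fun σ => by ext; rfl
      right_inv := fun τ => by
        funext c
        induction c using SimpleGraph.ConnectedComponent.ind
        rfl }
  rw [Nat.card_congr e, Nat.card_fun, Nat.card_eq_fintype_card, Fintype.card_fin, numComponents]

open Classical in
theorem numComponents_insert_of_connected {A : Finset G.edgeSet} {e : G.edgeSet}
    (h : EndsConnected A e) [NeZero q] :
    q ^ numComponents (insert e A) = q ^ numComponents A := by
  rw [← card_colourings, ← card_colourings]
  congr 2
  ext σ
  simp only [mem_colourings, Finset.forall_mem_insert]
  exact ⟨fun hσ => hσ.2, fun hσ => ⟨fun u hu v hv => eq_of_reachable hσ (h u hu v hv), hσ⟩⟩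

open Classical in
-- For ends `u`, `v` of `e`, the homomorphism `σ ↦ σ u - σ v` has as kernel the colourings that also
-- respect `e`, and it is onto `Fin q` when `u` and `v` lie in different components.
theorem numComponents_insert_of_not_connected {A : Finset G.edgeSet} {e : G.edgeSet}
    (h : ¬ EndsConnected A e) [NeZero q] :
    q ^ numComponents A = q * q ^ numComponents (insert e A) := by
  simp only [EndsConnected, not_forall] at h
  obtain ⟨u, hu, v, hv, huv⟩ := h
  have hne : u ≠ v := fun h0 => huv (h0 ▸ SimpleGraph.Reachable.refl _)
  have he := (Sym2.mem_and_mem_iff hne).1 ⟨hu, hv⟩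
  let φ : colourings q A →+ Fin q :=
    { toFun := fun σ => (σ : V → Fin q) u - (σ : V → Fin q) v
      map_zero' := by simp
      map_add' := fun σ τ => by simp; abel }
  have hsurj : Function.Surjective φ := by
    intro k
    -- The preimage of `k` is `k` on the component of `u` and `0` elsewhere, in particular at `v`.
    refine ⟨⟨fun x => if (subgraphOf A).Reachable u x then k else 0, ?_⟩, ?_⟩
    · intro a ha x hx y hy
      have hxy := reachable_of_mem ha hx hy
      have : (subgraphOf A).Reachable u x ↔ (subgraphOf A).Reachable u y :=
        ⟨fun h => h.trans hxy, fun h => h.trans hxy.symm⟩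
      simp [this]
    · simp [φ, huv]
  have hker : Nat.card φ.ker = Nat.card (colourings q (insert e A)) := by
    refine Nat.card_congr
      { toFun := fun σ => ⟨σ.1.1, ?_⟩
        invFun := fun τ => ⟨⟨τ.1, fun a ha => τ.2 a (Finset.mem_insert_of_mem ha)⟩, ?_⟩
        left_inv := fun σ => rfl
        right_inv := fun τ => rfl }
    · have h0 : (σ.1 : V → Fin q) u = (σ.1 : V → Fin q) v := sub_eq_zero.1 σ.2
      rw [mem_colourings, Finset.forall_mem_insert]
      refine ⟨fun x hx y hy => ?_, σ.1.2⟩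
      rw [he, Sym2.mem_iff] at hx hy
      rcases hx with rfl | rfl <;> rcases hy with rfl | rfl <;> simp [h0]
    · exact sub_eq_zero.2 ((τ.2 e (Finset.mem_insert_self e A)).apply_eq hu hv)
  rw [← card_colourings, ← card_colourings, ← hker,
    φ.ker.card_eq_card_quotient_mul_card_addSubgroup,
    Nat.card_congr (QuotientAddGroup.quotientKerEquivOfSurjective φ hsurj).toEquiv,
    Nat.card_eq_fintype_card, Fintype.card_fin]

end Colourings

/-! ### Exchanging two edge sets across a cut -/

section Mix

variable {V : Type*} {G : SimpleGraph V} {q : ℕ}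

open Classical in
/-- The set of edges that agrees with `B` on `L` and with `A` outside of `L`. -/
noncomputable def mix (L A B : Finset G.edgeSet) : Finset G.edgeSet := (B ∩ L) ∪ (A \ L)

theorem mem_mix {L A B : Finset G.edgeSet} {e : G.edgeSet} :
    e ∈ mix L A B ↔ (e ∈ L ∧ e ∈ B) ∨ (e ∉ L ∧ e ∈ A) := by
  simp [mix]; tauto

theorem mix_mix (L A B : Finset G.edgeSet) : mix L (mix L A B) (mix L B A) = A := by
  ext e
  simp only [mem_mix]
  tauto

theorem mix_empty (A B : Finset G.edgeSet) : mix ∅ A B = A := by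
  ext e; simp [mem_mix]

theorem mix_univ [Fintype G.edgeSet] (A B : Finset G.edgeSet) : mix Finset.univ A B = B := by
  ext e; simp [mem_mix]

theorem card_mix_add_card_mix (L A B : Finset G.edgeSet) :
    (mix L A B).card + (mix L B A).card = A.card + B.card := by
  classical
  have h : ∀ A B : Finset G.edgeSet, (mix L A B).card = (B ∩ L).card + (A \ L).card := by
    intro A B
    have e : mix L A B = (B ∩ L) ∪ (A \ L) := by
      ext; simp [mem_mix]; tauto
    rw [e]
    refine Finset.card_union_of_disjoint (Finset.disjoint_left.2 fun x hx hx' => ?_)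
    simp only [Finset.mem_inter, Finset.mem_sdiff] at hx hx'
    exact hx'.2 hx.2
  rw [h, h, ← Finset.card_inter_add_card_sdiff A L, ← Finset.card_inter_add_card_sdiff B L]
  ring

/-- The vertices incident both to an edge in `L` and to an edge outside of `L`. -/
def boundary (L : Finset G.edgeSet) : Set V :=
  {v | (∃ e ∈ L, v ∈ (e : Sym2 V)) ∧ ∃ e ∉ L, v ∈ (e : Sym2 V)}

variable [Finite V]

/-- Restricting `σ - τ` to the boundary has a kernel of index at most `q ^ (boundary L).ncard`. A
pair in the kernel agrees on the boundary, so exchanging `σ` and `τ` on the vertices touched by `L`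
gives colourings for the two mixed edge sets. The exchange is injective. -/
theorem pow_numComponents_mul_le [NeZero q] (L A B : Finset G.edgeSet) :
    q ^ numComponents A * q ^ numComponents B ≤
      q ^ (boundary L).ncard * (q ^ numComponents (mix L A B) * q ^ numComponents (mix L B A)) := by
  classical
  let φ : colourings q A × colourings q B →+ (boundary L → Fin q) :=
    { toFun := fun s x => (s.1 : V → Fin q) x - (s.2 : V → Fin q) x
      map_zero' := by ext; simp
      map_add' := fun s t => by funext x; simp; abel }
  have hcard : Nat.card (colourings q A × colourings q B) ≤
      q ^ (boundary L).ncard * Nat.card φ.ker := by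
    rw [φ.ker.card_eq_card_quotient_mul_card_addSubgroup]
    refine Nat.mul_le_mul_right _ ?_
    have := Nat.card_le_card_of_injective _ (QuotientAddGroup.kerLift_injective φ)
    simpa [Nat.card_fun, Nat.card_coe_set_eq] using this
  have hmix : ∀ (C D : Finset G.edgeSet) (σ τ : V → Fin q), σ ∈ colourings q C →
      τ ∈ colourings q D → (∀ x ∈ boundary L, σ x = τ x) →
      (fun v => if ∃ e ∈ L, v ∈ (e : Sym2 V) then τ v else σ v) ∈ colourings q (mix L C D) := by
    intro C D σ τ hσ hτ hST e he
    rcases mem_mix.1 he with ⟨heL, heD⟩ | ⟨heL, heC⟩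
    · intro u hu v hv
      have h1 : ∃ e ∈ L, u ∈ (e : Sym2 V) := ⟨e, heL, hu⟩
      have h2 : ∃ e ∈ L, v ∈ (e : Sym2 V) := ⟨e, heL, hv⟩
      simp only [if_pos h1, if_pos h2]
      exact hτ e heD u hu v hv
    -- An edge outside `L` meets the vertices touched by `L` only in boundary vertices, where both
    -- colourings agree.
    · have key : ∀ u ∈ (e : Sym2 V), (if ∃ e ∈ L, u ∈ (e : Sym2 V) then τ u else σ u) = σ u := by
        intro u hu
        split_ifs with h1
        · exact (hST u ⟨h1, e, heL, hu⟩).symm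
        · rfl
      intro u hu v hv
      simp only [key u hu, key v hv]
      exact hσ e heC u hu v hv
  have heq : ∀ s : φ.ker, ∀ x ∈ boundary L, (s.1.1 : V → Fin q) x = (s.1.2 : V → Fin q) x :=
    fun s x hx => sub_eq_zero.1 (congrFun s.2 ⟨x, hx⟩)
  let ψ : φ.ker → colourings q (mix L A B) × colourings q (mix L B A) := fun s =>
    (⟨_, hmix A B s.1.1 s.1.2 s.1.1.2 s.1.2.2 (heq s)⟩,
      ⟨_, hmix B A s.1.2 s.1.1 s.1.2.2 s.1.1.2 fun x hx => (heq s x hx).symm⟩)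
  have hψ : Function.Injective ψ := by
    intro s t hst
    have h1 := congrArg (fun z => (z.1 : V → Fin q)) hst
    have h2 := congrArg (fun z => (z.2 : V → Fin q)) hst
    simp only [ψ] at h1 h2
    ext v
    · by_cases hv : ∃ e ∈ L, v ∈ (e : Sym2 V)
      · have := congrFun h2 v
        simp only [if_pos hv] at this
        rw [this]
      · have := congrFun h1 v
        simp only [if_neg hv] at this
        rw [this]
    · by_cases hv : ∃ e ∈ L, v ∈ (e : Sym2 V)
      · have := congrFun h1 v
        simp only [if_pos hv] at this
        rw [this]
      · have := congrFun h2 v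
        simp only [if_neg hv] at this
        rw [this]
  have hle := Nat.card_le_card_of_injective ψ hψ
  rw [Nat.card_prod, card_colourings, card_colourings] at hle hcard
  exact hcard.trans (Nat.mul_le_mul_left _ hle)

end Mix

end RandomCluster

namespace RandomCluster

open Matrix

/-! ### Quadratic forms of the edge updates -/

section Forms

open Classical

variable {V : Type*} {G : SimpleGraph V} {p : ℝ} {q : ℕ}

theorem weight_pos (hp0 : 0 < p) (hp1 : p < 1) (hq : 0 < q) (A : Finset G.edgeSet) :
    0 < weight p q A := by
  have : 0 < 1 - p := by linarith
  have : (0 : ℝ) < q := by exact_mod_cast hq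
  unfold weight
  positivity

theorem updateProb_of_mem {A : Finset G.edgeSet} {e : G.edgeSet} (he : e ∈ A) :
    updateProb p q A e = p := if_pos (endsConnected_of_mem he)

/-- Detailed balance between `A` and `insert e A`: with `e` present its ends are connected, so it is
removed with probability `1 - p`. If `e` joins two components, the lost factor `q` in the weight is
offset by `p / q` replacing `p`. -/
theorem weight_mul_updateProb [Finite V] [NeZero q] (hp1 : p < 1) {A : Finset G.edgeSet}
    {e : G.edgeSet} (he : e ∉ A) :
    weight p q A * updateProb p q A e = weight p q (insert e A) * (1 - p) := by
  have h1 : 1 - p ≠ 0 := by linarith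
  have hq : (q : ℝ) ≠ 0 := Nat.cast_ne_zero.2 (NeZero.ne q)
  unfold weight updateProb
  rw [Finset.card_insert_of_notMem he, pow_succ]
  split_ifs with h
  · have := numComponents_insert_of_connected (q := q) h
    have h' : (q : ℝ) ^ numComponents (insert e A) = (q : ℝ) ^ numComponents A := by
      exact_mod_cast this
    rw [h']
    field_simp
  · have := numComponents_insert_of_not_connected (q := q) h
    have h' : (q : ℝ) ^ numComponents A = q * (q : ℝ) ^ numComponents (insert e A) := by
      exact_mod_cast this
    rw [h']
    field_simp

theorem updateProb_ge [NeZero q] (hp0 : 0 < p) (A : Finset G.edgeSet) (e : G.edgeSet) :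
    p / q ≤ updateProb p q A e := by
  have : (1 : ℝ) ≤ q := by exact_mod_cast NeZero.one_le
  unfold updateProb
  split_ifs
  · exact div_le_self hp0.le this
  · exact le_rfl

theorem updateProb_le [NeZero q] (hp0 : 0 < p) (A : Finset G.edgeSet) (e : G.edgeSet) :
    updateProb p q A e ≤ p := by
  have : (1 : ℝ) ≤ q := by exact_mod_cast NeZero.one_le
  unfold updateProb
  split_ifs
  · exact le_rfl
  · exact div_le_self hp0.le this

theorem edgeUpdate_apply_of_notMem {A B : Finset G.edgeSet} {e : G.edgeSet} (he : e ∉ B) :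
    edgeUpdate p q e A B = if B = A.erase e then 1 - updateProb p q A e else 0 := by
  have h1 : A ∆ B ⊆ {e} ↔ B = A.erase e := by
    constructor
    · intro h
      ext a
      have := @h a
      simp only [Finset.mem_symmDiff, Finset.mem_singleton, Finset.mem_erase] at this ⊢
      by_cases hae : a = e
      · subst hae; tauto
      · tauto
    · rintro rfl a
      simp only [Finset.mem_symmDiff, Finset.mem_singleton, Finset.mem_erase]
      tauto
  have h2 : B ∩ {e} = ∅ := Finset.inter_singleton_of_notMem he
  simp only [edgeUpdate, Matrix.of_apply, h1, h2]
  simp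

theorem edgeUpdate_apply_insert {A B : Finset G.edgeSet} {e : G.edgeSet} (he : e ∉ B) :
    edgeUpdate p q e A (insert e B) = if B = A.erase e then updateProb p q A e else 0 := by
  have h1 : A ∆ (insert e B) ⊆ {e} ↔ B = A.erase e := by
    constructor
    · intro h
      ext a
      have := @h a
      simp only [Finset.mem_symmDiff, Finset.mem_singleton, Finset.mem_erase,
        Finset.mem_insert] at this ⊢
      by_cases hae : a = e
      · subst hae; tauto
      · tauto
    · rintro rfl a
      simp only [Finset.mem_symmDiff, Finset.mem_singleton, Finset.mem_erase, Finset.mem_insert]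
      tauto
  have h2 : insert e B ∩ {e} = {e} := Finset.inter_singleton_of_mem (Finset.mem_insert_self e B)
  simp only [edgeUpdate, Matrix.of_apply, h1, h2]
  simp

variable [Fintype G.edgeSet]

/-- The update of `e` acts separately on each pair `A`, `insert e A`, so sums over states are
arranged by these pairs. -/
theorem sum_eq_sum_notMem (e : G.edgeSet) (F : Finset G.edgeSet → ℝ) :
    ∑ A, F A = ∑ A with e ∉ A, (F A + F (insert e A)) := by
  rw [Finset.sum_add_distrib, ← Finset.sum_filter_add_sum_filter_not Finset.univ (fun A => e ∉ A)]
  congr 1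
  refine Finset.sum_nbij' (fun A => A.erase e) (fun A => insert e A) ?_ ?_ ?_ ?_ ?_
  · simp
  · simp
  · intro A hA
    simp only [Finset.mem_filter, Finset.mem_univ, true_and, not_not] at hA
    exact Finset.insert_erase hA
  · intro A hA
    simp only [Finset.mem_filter, Finset.mem_univ, true_and] at hA
    exact Finset.erase_insert hA
  · intro A hA
    simp only [Finset.mem_filter, Finset.mem_univ, true_and, not_not] at hA
    rw [Finset.insert_erase hA]

theorem edgeUpdate_mulVec (e : G.edgeSet) (f : Finset G.edgeSet → ℝ) (A : Finset G.edgeSet) :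
    (edgeUpdate p q e *ᵥ f) A =
      updateProb p q A e * f (insert e A) + (1 - updateProb p q A e) * f (A.erase e) := by
  simp only [Matrix.mulVec, dotProduct]
  rw [sum_eq_sum_notMem e, Finset.sum_eq_single (A.erase e)]
  · rw [edgeUpdate_apply_of_notMem (Finset.notMem_erase e A),
      edgeUpdate_apply_insert (Finset.notMem_erase e A), if_pos rfl, if_pos rfl]
    have : insert e (A.erase e) = insert e A := by
      ext a; by_cases h : a = e <;> simp [h]
    rw [this]
    ring
  · intro B hB hne
    simp only [Finset.mem_filter, Finset.mem_univ, true_and] at hB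
    rw [edgeUpdate_apply_of_notMem hB, edgeUpdate_apply_insert hB, if_neg hne, if_neg hne]
    ring
  · simp

theorem singleBond_mulVec (f : Finset G.edgeSet → ℝ) (A : Finset G.edgeSet) :
    (singleBond G p q *ᵥ f) A = 1 / 2 * f A +
      1 / (2 * (Fintype.card G.edgeSet : ℝ)) * ∑ e, (edgeUpdate p q e *ᵥ f) A := by
  rw [singleBond, Matrix.add_mulVec, Matrix.smul_mulVec, Matrix.smul_mulVec, Matrix.one_mulVec,
    Matrix.sum_mulVec]
  simp

/-- The bilinear form of the update of the edge `e`. -/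
theorem edgeUpdate_form [Finite V] [NeZero q] (hp1 : p < 1) (e : G.edgeSet)
    (f g : Finset G.edgeSet → ℝ) :
    ∑ A, weight p q A * (f A * (edgeUpdate p q e *ᵥ g) A) =
      ∑ A with e ∉ A, ((weight p q A - weight p q (insert e A) * (1 - p)) * (f A * g A) +
        weight p q (insert e A) * (1 - p) * (f A * g (insert e A) + f (insert e A) * g A) +
        weight p q (insert e A) * p * (f (insert e A) * g (insert e A))) := by
  rw [sum_eq_sum_notMem e]
  refine Finset.sum_congr rfl fun A hA => ?_
  simp only [Finset.mem_filter, Finset.mem_univ, true_and] at hA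
  rw [edgeUpdate_mulVec, edgeUpdate_mulVec, updateProb_of_mem (Finset.mem_insert_self e A),
    Finset.insert_idem, Finset.erase_insert hA, Finset.erase_eq_of_notMem hA,
    ← weight_mul_updateProb hp1 hA]
  have := weight_mul_updateProb (q := q) hp1 hA
  linear_combination (-(f (insert e A) * g A)) * this

theorem edgeUpdate_form_symm [Finite V] [NeZero q] (hp1 : p < 1) (e : G.edgeSet)
    (f g : Finset G.edgeSet → ℝ) :
    ∑ A, weight p q A * (f A * (edgeUpdate p q e *ᵥ g) A) =
      ∑ A, weight p q A * (g A * (edgeUpdate p q e *ᵥ f) A) := by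
  rw [edgeUpdate_form hp1, edgeUpdate_form hp1]
  exact Finset.sum_congr rfl fun A _ => by ring

/-- The Dirichlet form of the update of the edge `e`. -/
theorem edgeUpdate_dirichlet [Finite V] [NeZero q] (hp1 : p < 1) (e : G.edgeSet)
    (f : Finset G.edgeSet → ℝ) :
    ∑ A, weight p q A * f A ^ 2 - ∑ A, weight p q A * (f A * (edgeUpdate p q e *ᵥ f) A) =
      ∑ A with e ∉ A, (1 - p) * weight p q (insert e A) * (f (insert e A) - f A) ^ 2 := by
  rw [edgeUpdate_form hp1, sum_eq_sum_notMem e, ← Finset.sum_sub_distrib]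
  exact Finset.sum_congr rfl fun A _ => by ring

theorem singleBond_form (f g : Finset G.edgeSet → ℝ) :
    ∑ A, weight p q A * (f A * (singleBond G p q *ᵥ g) A) =
      1 / 2 * ∑ A, weight p q A * (f A * g A) + 1 / (2 * (Fintype.card G.edgeSet : ℝ)) *
        ∑ e, ∑ A, weight p q A * (f A * (edgeUpdate p q e *ᵥ g) A) := by
  rw [Finset.sum_comm, Finset.mul_sum, Finset.mul_sum, ← Finset.sum_add_distrib]
  refine Finset.sum_congr rfl fun A _ => ?_
  rw [singleBond_mulVec, ← Finset.mul_sum, ← Finset.mul_sum]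
  ring

/-! ### The Edwards-Sokal coupling and the comparison of the two chains -/

/-- The weight of the pair `(σ, A)` in the coupling of colourings and edge sets. -/
noncomputable def jointWeight (p : ℝ) (σ : V → Fin q) (A : Finset G.edgeSet) : ℝ :=
  (p / (1 - p)) ^ A.card * if ∀ e ∈ A, Monochromatic σ e then 1 else 0

theorem jointWeight_nonneg (hp0 : 0 < p) (hp1 : p < 1) (σ : V → Fin q) (A : Finset G.edgeSet) :
    0 ≤ jointWeight p σ A := by
  have : 0 < 1 - p := by linarith
  unfold jointWeight
  positivity

theorem jointWeight_insert {A : Finset G.edgeSet} {e : G.edgeSet} (he : e ∉ A) (σ : V → Fin q) :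
    jointWeight p σ (insert e A) =
      jointWeight p σ A * (if Monochromatic σ e then p / (1 - p) else 0) := by
  unfold jointWeight
  rw [Finset.card_insert_of_notMem he, pow_succ]
  by_cases h : Monochromatic σ e
  · simp only [Finset.forall_mem_insert, h, true_and, if_true]
    ring
  · simp [h]

/-- The binomial theorem over subsets of the monochromatic edges: once normalised, `jointWeight p σ`
is percolation with parameter `p` on those edges. -/
theorem sum_jointWeight (hp1 : p < 1) (σ : V → Fin q) :
    (1 - p) ^ (monochromaticEdges G σ).card * ∑ A : Finset G.edgeSet, jointWeight p σ A = 1 := by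
  have h1 : 1 - p ≠ 0 := by linarith
  have : ∑ A : Finset G.edgeSet, jointWeight p σ A =
      (1 + p / (1 - p)) ^ (monochromaticEdges G σ).card := by
    have h2 := Finset.prod_one_add (f := fun _ : G.edgeSet => p / (1 - p))
      (monochromaticEdges G σ)
    rw [Finset.prod_const] at h2
    rw [h2]
    simp only [jointWeight, Finset.prod_const, mul_ite, mul_one, mul_zero]
    rw [← Finset.sum_filter]
    refine Finset.sum_congr ?_ fun _ _ => rfl
    ext A
    simp [Finset.subset_iff, monochromaticEdges]
  rw [this, ← mul_pow]
  have : (1 - p) * (1 + p / (1 - p)) = 1 := by field_simp; ring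
  rw [this, one_pow]

variable [Fintype V]

theorem sum_indicator_eq_pow [NeZero q] (A : Finset G.edgeSet) :
    ∑ σ : V → Fin q, (if ∀ e ∈ A, Monochromatic σ e then (1 : ℝ) else 0) =
      (q : ℝ) ^ numComponents A := by
  have h := card_colourings (q := q) A
  rw [Finset.sum_boole, ← Nat.cast_pow, ← h]
  congr 1
  rw [← Fintype.card_subtype, ← Nat.card_eq_fintype_card]
  rfl

theorem weight_eq_sum_jointWeight [NeZero q] (A : Finset G.edgeSet) :
    weight p q A = ∑ σ : V → Fin q, jointWeight p σ A := by
  simp only [weight, jointWeight]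
  rw [← Finset.mul_sum, sum_indicator_eq_pow]

theorem weight_mul_swendsenWang [NeZero q] (A B : Finset G.edgeSet) :
    weight p q A * swendsenWang G p q A B =
      ∑ σ : V → Fin q, (1 - p) ^ (monochromaticEdges G σ).card *
        (jointWeight p σ A * jointWeight p σ B) := by
  have hq : (q : ℝ) ^ numComponents A ≠ 0 := pow_ne_zero _ (Nat.cast_ne_zero.2 (NeZero.ne q))
  simp only [weight, swendsenWang, Matrix.of_apply]
  rw [show ∀ a b c d s : ℝ, a * b * (c * d * s) = (b * c) * (a * d * s) from
    fun a b c d s => by ring, mul_inv_cancel₀ hq, one_mul, Finset.mul_sum]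
  refine Finset.sum_congr rfl fun σ _ => ?_
  have : (∀ e ∈ A ∪ B, Monochromatic σ e) ↔
      (∀ e ∈ A, Monochromatic σ e) ∧ ∀ e ∈ B, Monochromatic σ e := Finset.forall_mem_union
  simp only [jointWeight, this, ite_and]
  split_ifs <;> ring

/-- Swendsen-Wang passes to a colouring and back, so it is an operator composed with its adjoint. On
the diagonal the form is a sum of squares, which gives positivity. -/
theorem swendsenWang_form [NeZero q] (f g : Finset G.edgeSet → ℝ) :
    ∑ A, weight p q A * (f A * (swendsenWang G p q *ᵥ g) A) =
      ∑ σ : V → Fin q, (1 - p) ^ (monochromaticEdges G σ).card *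
        ((∑ A, jointWeight p σ A * f A) * ∑ A, jointWeight p σ A * g A) := by
  have : ∀ A, weight p q A * (f A * (swendsenWang G p q *ᵥ g) A) =
      ∑ σ : V → Fin q, (1 - p) ^ (monochromaticEdges G σ).card *
        ((jointWeight p σ A * f A) * ∑ B, jointWeight p σ B * g B) := by
    intro A
    simp only [Matrix.mulVec, dotProduct, Finset.mul_sum]
    rw [Finset.sum_comm]
    refine Finset.sum_congr rfl fun B _ => ?_
    rw [show ∀ a b c d : ℝ, a * (b * (c * d)) = (a * c) * (b * d) from fun a b c d => by ring,
      weight_mul_swendsenWang, Finset.sum_mul]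
    exact Finset.sum_congr rfl fun σ _ => by ring
  simp only [this]
  rw [Finset.sum_comm]
  refine Finset.sum_congr rfl fun σ _ => ?_
  rw [← Finset.mul_sum, ← Finset.sum_mul]

theorem swendsenWang_mulVec_one [NeZero q] (hp0 : 0 < p) (hp1 : p < 1) :
    swendsenWang G p q *ᵥ 1 = 1 := by
  funext A
  have hw := weight_pos (q := q) hp0 hp1 (Nat.pos_of_neZero q) A
  refine mul_left_cancel₀ hw.ne' ?_
  simp only [Matrix.mulVec, dotProduct, Pi.one_apply, mul_one]
  rw [Finset.mul_sum, Finset.sum_congr rfl fun B _ => weight_mul_swendsenWang A B,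
    Finset.sum_comm, weight_eq_sum_jointWeight]
  refine Finset.sum_congr rfl fun σ _ => ?_
  rw [← Finset.mul_sum, ← Finset.mul_sum]
  linear_combination jointWeight p σ A * sum_jointWeight (G := G) hp1 σ

theorem isReversiblePSD_swendsenWang [NeZero q] (hp0 : 0 < p) (hp1 : p < 1) :
    MarkovChain.IsReversiblePSD (swendsenWang G p q) (weight p q) where
  pos := weight_pos hp0 hp1 (Nat.pos_of_neZero q)
  mulVec_one := swendsenWang_mulVec_one hp0 hp1
  symm f g := by
    rw [swendsenWang_form, swendsenWang_form]
    exact Finset.sum_congr rfl fun σ _ => by ring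
  nonneg f := by
    rw [swendsenWang_form]
    have : 0 < 1 - p := by linarith
    exact Finset.sum_nonneg fun σ _ => mul_nonneg (by positivity) (mul_self_nonneg _)

/-- Updating one edge given the colouring contracts less than updating all the edges. -/
theorem swendsenWang_form_le_edgeUpdate_form [NeZero q] (hp0 : 0 < p) (hp1 : p < 1)
    (e : G.edgeSet) (f : Finset G.edgeSet → ℝ) :
    ∑ A, weight p q A * (f A * (swendsenWang G p q *ᵥ f) A) ≤
      ∑ A, weight p q A * (f A * (edgeUpdate p q e *ᵥ f) A) := by
  have h1 : 0 < 1 - p := by linarith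
  -- The edge update is also a passage to a colouring and back that redraws only `e`. Given `σ`, the
  -- odds of `e` being present are p/(1-p) or 0, and `f` is averaged over the two states of `e`.
  have hR : ∑ A, weight p q A * (f A * (edgeUpdate p q e *ᵥ f) A) =
      ∑ σ : V → Fin q, ∑ A with e ∉ A, jointWeight p σ A *
        ((f A + (if Monochromatic σ e then p / (1 - p) else 0) * f (insert e A)) ^ 2 /
          (1 + if Monochromatic σ e then p / (1 - p) else 0)) := by
    rw [edgeUpdate_form hp1, Finset.sum_comm]
    refine Finset.sum_congr rfl fun A hA => ?_
    simp only [Finset.mem_filter, Finset.mem_univ, true_and] at hA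
    rw [weight_eq_sum_jointWeight, weight_eq_sum_jointWeight]
    simp only [jointWeight_insert hA, Finset.sum_mul, ← Finset.sum_sub_distrib,
      ← Finset.sum_add_distrib]
    refine Finset.sum_congr rfl fun σ _ => ?_
    split_ifs
    · have : 1 + p / (1 - p) = 1 / (1 - p) := by field_simp; ring
      rw [this]
      field_simp
      ring
    · simp only [mul_zero, zero_mul, add_zero, div_one]
      ring
  rw [hR, swendsenWang_form]
  refine Finset.sum_le_sum fun σ _ => ?_
  set x : ℝ := if Monochromatic σ e then p / (1 - p) else 0 with hx
  have hx0 : 0 ≤ x := by rw [hx]; split_ifs <;> positivity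
  set M : ℝ := (1 - p) ^ (monochromaticEdges G σ).card
  have hM : 0 < M := by positivity
  have hsum : ∀ g : Finset G.edgeSet → ℝ, ∑ A, jointWeight p σ A * g A =
      ∑ A with e ∉ A, jointWeight p σ A * (g A + x * g (insert e A)) := by
    intro g
    rw [sum_eq_sum_notMem e]
    refine Finset.sum_congr rfl fun A hA => ?_
    simp only [Finset.mem_filter, Finset.mem_univ, true_and] at hA
    rw [jointWeight_insert hA, ← hx]
    ring
  have htot : M * ((∑ A with e ∉ A, jointWeight p σ A) * (1 + x)) = 1 := by
    have := hsum 1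
    simp only [Pi.one_apply, mul_one, ← Finset.sum_mul] at this
    rw [← this]
    exact sum_jointWeight hp1 σ
  -- The square of the mean over all edges is at most the mean of the squared averages over `e`;
  -- `htot` is the normalisation.
  have hCS := Finset.sum_sq_le_sum_mul_sum_of_sq_le_mul
    (Finset.univ.filter fun A : Finset G.edgeSet => e ∉ A)
    (r := fun A => jointWeight p σ A * (f A + x * f (insert e A)))
    (f := fun A => jointWeight p σ A)
    (g := fun A => jointWeight p σ A * (f A + x * f (insert e A)) ^ 2)
    (fun A _ => jointWeight_nonneg hp0 hp1 σ A)
    (fun A _ => mul_nonneg (jointWeight_nonneg hp0 hp1 σ A) (sq_nonneg _))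
    (fun A _ => le_of_eq (by ring))
  rw [hsum f, ← sq]
  simp only [← mul_div_assoc]
  rw [← Finset.sum_div, le_div_iff₀ (by positivity)]
  calc _ ≤ M * ((∑ A with e ∉ A, jointWeight p σ A) *
        ∑ A with e ∉ A, jointWeight p σ A * (f A + x * f (insert e A)) ^ 2) * (1 + x) := by
        gcongr
    _ = (M * ((∑ A with e ∉ A, jointWeight p σ A) * (1 + x))) *
        ∑ A with e ∉ A, jointWeight p σ A * (f A + x * f (insert e A)) ^ 2 := by ring
    _ = _ := by rw [htot, one_mul]

theorem edgeUpdate_form_le [NeZero q] (hp0 : 0 < p) (hp1 : p < 1)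
    (e : G.edgeSet) (f : Finset G.edgeSet → ℝ) :
    ∑ A, weight p q A * (f A * (edgeUpdate p q e *ᵥ f) A) ≤ ∑ A, weight p q A * f A ^ 2 := by
  have h1 : 0 ≤ 1 - p := by linarith
  rw [← sub_nonneg, edgeUpdate_dirichlet hp1]
  exact Finset.sum_nonneg fun A _ => mul_nonneg (mul_nonneg h1
    (weight_pos hp0 hp1 (Nat.pos_of_neZero q) _).le) (sq_nonneg _)

/-- The lazy chain is half the identity plus half the average of the edge updates, and each of these
forms dominates the Swendsen-Wang form. -/
theorem swendsenWang_form_le_singleBond_form [NeZero q] [Nonempty G.edgeSet] (hp0 : 0 < p)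
    (hp1 : p < 1) (f : Finset G.edgeSet → ℝ) :
    ∑ A, weight p q A * (f A * (swendsenWang G p q *ᵥ f) A) ≤
      ∑ A, weight p q A * (f A * (singleBond G p q *ᵥ f) A) := by
  set s := ∑ A, weight p q A * (f A * (swendsenWang G p q *ᵥ f) A)
  have hm : (0 : ℝ) < Fintype.card G.edgeSet := by exact_mod_cast Fintype.card_pos
  have h1 : (Fintype.card G.edgeSet : ℝ) * s ≤
      ∑ e, ∑ A, weight p q A * (f A * (edgeUpdate p q e *ᵥ f) A) := by
    have := Finset.sum_le_sum fun (e : G.edgeSet) (_ : e ∈ Finset.univ) =>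
      swendsenWang_form_le_edgeUpdate_form (q := q) hp0 hp1 e f
    simpa using this
  have h2 : s ≤ ∑ A, weight p q A * (f A * f A) := by
    obtain ⟨e⟩ := ‹Nonempty G.edgeSet›
    refine (swendsenWang_form_le_edgeUpdate_form hp0 hp1 e f).trans
      ((edgeUpdate_form_le hp0 hp1 e f).trans (le_of_eq ?_))
    exact Finset.sum_congr rfl fun A _ => by ring
  rw [singleBond_form]
  have h3 := mul_le_mul_of_nonneg_left h1
    (show 0 ≤ 1 / (2 * (Fintype.card G.edgeSet : ℝ)) by positivity)
  have h4 : 1 / (2 * (Fintype.card G.edgeSet : ℝ)) * ((Fintype.card G.edgeSet : ℝ) * s) = s / 2 := by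
    field_simp
  linarith

theorem isReversiblePSD_singleBond [NeZero q] [Nonempty G.edgeSet] (hp0 : 0 < p) (hp1 : p < 1) :
    MarkovChain.IsReversiblePSD (singleBond G p q) (weight p q) where
  pos := weight_pos hp0 hp1 (Nat.pos_of_neZero q)
  mulVec_one := by
    have hm : (Fintype.card G.edgeSet : ℝ) ≠ 0 := Nat.cast_ne_zero.2 Fintype.card_ne_zero
    funext A
    simp only [singleBond_mulVec, edgeUpdate_mulVec, Pi.one_apply, mul_one, add_sub_cancel,
      Finset.sum_const, Finset.card_univ, nsmul_eq_mul]
    field_simp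
    norm_num
  symm f g := by
    rw [singleBond_form, singleBond_form]
    congr 2
    · exact Finset.sum_congr rfl fun A _ => by ring
    · exact Finset.sum_congr rfl fun e _ => edgeUpdate_form_symm hp1 e f g
  nonneg f := ((isReversiblePSD_swendsenWang hp0 hp1).nonneg f).trans
    (swendsenWang_form_le_singleBond_form hp0 hp1 f)

theorem singleBond_dirichlet [NeZero q] [Nonempty G.edgeSet] (hp1 : p < 1)
    (f : Finset G.edgeSet → ℝ) :
    ∑ A, weight p q A * f A ^ 2 - ∑ A, weight p q A * (f A * (singleBond G p q *ᵥ f) A) =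
      1 / (2 * (Fintype.card G.edgeSet : ℝ)) * ∑ e : G.edgeSet, ∑ A with e ∉ A,
        (1 - p) * weight p q (insert e A) * (f (insert e A) - f A) ^ 2 := by
  have hm : (Fintype.card G.edgeSet : ℝ) ≠ 0 := Nat.cast_ne_zero.2 Fintype.card_ne_zero
  simp only [← edgeUpdate_dirichlet hp1, Finset.sum_sub_distrib, singleBond_form,
    Finset.sum_const, Finset.card_univ, nsmul_eq_mul, ← sq]
  field_simp
  ring

end Forms

end RandomCluster

namespace RandomCluster

open Matrix

/-! ### Canonical paths and the Poincaré inequality -/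

section CanonicalPaths

open Classical

variable {V : Type*} {G : SimpleGraph V} {p : ℝ} {q : ℕ}

/-- Mixing preserves the total number of edges, so only the component counts can lose, and the
boundary controls that loss. -/
theorem weight_mul_weight_le [Finite V] [NeZero q] (hp0 : 0 < p) (hp1 : p < 1) {ℓ : ℕ}
    {L : Finset G.edgeSet} (hL : (boundary L).ncard ≤ ℓ) (A B : Finset G.edgeSet) :
    weight p q A * weight p q B ≤
      (q : ℝ) ^ ℓ * (weight p q (mix L A B) * weight p q (mix L B A)) := by
  have h1 : 0 < 1 - p := by linarith
  have hq : (1 : ℝ) ≤ q := by exact_mod_cast NeZero.one_le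
  have h2 : (q : ℝ) ^ numComponents A * (q : ℝ) ^ numComponents B ≤ (q : ℝ) ^ (boundary L).ncard *
      ((q : ℝ) ^ numComponents (mix L A B) * (q : ℝ) ^ numComponents (mix L B A)) := by
    exact_mod_cast pow_numComponents_mul_le (q := q) L A B
  have h3 : (q : ℝ) ^ (boundary L).ncard ≤ (q : ℝ) ^ ℓ := pow_le_pow_right₀ hq hL
  have h4 := card_mix_add_card_mix L A B
  unfold weight
  calc _ = (p / (1 - p)) ^ (A.card + B.card) *
        ((q : ℝ) ^ numComponents A * (q : ℝ) ^ numComponents B) := by rw [pow_add]; ring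
    _ ≤ (p / (1 - p)) ^ (A.card + B.card) * ((q : ℝ) ^ ℓ *
      ((q : ℝ) ^ numComponents (mix L A B) * (q : ℝ) ^ numComponents (mix L B A))) := by
        refine mul_le_mul_of_nonneg_left (h2.trans ?_) (by positivity)
        gcongr
    _ = _ := by rw [← h4, pow_add]; ring

/-- Detailed balance with the smallest possible update probability `p / q`; this is the source of
the extra factor `q` in `q ^ (ℓ + 1)`. -/
theorem weight_erase_le [Finite V] [NeZero q] (hp0 : 0 < p) (hp1 : p < 1)
    (A : Finset G.edgeSet) (e : G.edgeSet) :
    p * weight p q (A.erase e) ≤ q * ((1 - p) * weight p q (insert e A)) := by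
  have hq : (0 : ℝ) < q := by exact_mod_cast Nat.pos_of_neZero q
  have h1 := weight_mul_updateProb (q := q) hp1 (Finset.notMem_erase e A)
  have h2 := updateProb_ge (q := q) hp0 (A.erase e) e
  have h3 : insert e (A.erase e) = insert e A := by
    ext a; by_cases h : a = e <;> simp [h]
  rw [h3] at h1
  rw [mul_comm (1 - p), ← h1]
  have h4 := mul_le_mul_of_nonneg_left h2
    (weight_pos (q := q) hp0 hp1 (Nat.pos_of_neZero q) (A.erase e)).le
  have h5 := mul_le_mul_of_nonneg_left h4 hq.le
  refine le_trans (le_of_eq ?_) h5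
  field_simp

/-- One step of the canonical path from `A` to `B`, in terms of the current state `Z` and the
complementary state `W`. -/
theorem step_le [Finite V] [NeZero q] (hp0 : 0 < p) (hp1 : p < 1) {ℓ : ℕ}
    {L : Finset G.edgeSet} {e : G.edgeSet} (he : e ∉ L) (hL : (boundary L).ncard ≤ ℓ)
    (hL' : (boundary (insert e L)).ncard ≤ ℓ) (f : Finset G.edgeSet → ℝ)
    {A B Z W : Finset G.edgeSet} (hZ : Z = mix L A B) (hW : W = mix L B A) :
    weight p q A * weight p q B * (f (mix (insert e L) A B) - f Z) ^ 2 ≤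
      (q : ℝ) ^ (ℓ + 1) * ((1 - p) * weight p q (insert e Z) *
        (f (insert e Z) - f (Z.erase e)) ^ 2 *
        (weight p q (insert e W) + weight p q (W.erase e))) := by
  have hp : 0 < 1 - p := by linarith
  have hq : (1 : ℝ) ≤ q := by exact_mod_cast NeZero.one_le
  have hw := weight_pos (G := G) (q := q) hp0 hp1 (Nat.pos_of_neZero q)
  -- Weight the first bound by `1 - p` and the second by `p`, then turn the weight of `Z.erase e`
  -- into that of `insert e Z`. Using both bounds is what keeps `p` out of the constant.
  have arith : ∀ {v v' : ℝ}, 0 < v → 0 < v' →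
      weight p q A * weight p q B ≤ (q : ℝ) ^ ℓ * (weight p q (insert e Z) * v) →
      weight p q A * weight p q B ≤ (q : ℝ) ^ ℓ * (weight p q (Z.erase e) * v') →
      weight p q A * weight p q B ≤
        (q : ℝ) ^ (ℓ + 1) * ((1 - p) * weight p q (insert e Z) * (v + v')) := by
    intro v v' hv hv' ha hb
    have hy := hw (insert e Z)
    have h1 := mul_le_mul_of_nonneg_left ha hp.le
    have h2 := mul_le_mul_of_nonneg_left hb hp0.le
    have h3 := mul_le_mul_of_nonneg_left (weight_erase_le (q := q) hp0 hp1 Z e)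
      (show 0 ≤ (q : ℝ) ^ ℓ * v' by positivity)
    have h4 := mul_le_mul_of_nonneg_left hq
      (show 0 ≤ (q : ℝ) ^ ℓ * ((1 - p) * weight p q (insert e Z) * v) by positivity)
    rw [pow_succ]
    linarith
  have hmem1 : e ∈ Z ↔ e ∈ A := by simp [hZ, mem_mix, he]
  have hmem2 : e ∈ W ↔ e ∈ B := by simp [hW, mem_mix, he]
  have hb1 := weight_mul_weight_le (q := q) hp0 hp1 hL A B
  have hb2 := weight_mul_weight_le (q := q) hp0 hp1 hL' A B
  rw [← hZ, ← hW] at hb1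
  have hins : ∀ {A B Z : Finset G.edgeSet}, Z = mix L A B → e ∈ B →
      mix (insert e L) A B = insert e Z := by
    intro A B Z hZ hB
    ext a
    by_cases h : a = e
    · subst h; simp [mem_mix, hB]
    · simp [hZ, mem_mix, h]
  have hers : ∀ {A B Z : Finset G.edgeSet}, Z = mix L A B → e ∉ B →
      mix (insert e L) A B = Z.erase e := by
    intro A B Z hZ hB
    ext a
    by_cases h : a = e
    · subst h; simp [mem_mix, hB]
    · simp [hZ, mem_mix, h]
  have hnn : 0 ≤ (q : ℝ) ^ (ℓ + 1) * ((1 - p) * weight p q (insert e Z) *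
        (f (insert e Z) - f (Z.erase e)) ^ 2 *
        (weight p q (insert e W) + weight p q (W.erase e))) := by
    have h1 := hw (insert e Z)
    have h2 := hw (insert e W)
    have h3 := hw (W.erase e)
    positivity
  -- If `e` has the same status in `A` and `B`, the path does not move. Otherwise the cuts before
  -- and after `e` bound the product at the two ends of the step, one at `insert e Z` and one at
  -- `Z.erase e`.
  by_cases hA : e ∈ A <;> by_cases hB : e ∈ B
  · rw [hins hZ hB, Finset.insert_eq_of_mem (hmem1.2 hA), sub_self]
    rw [Finset.insert_eq_of_mem (hmem1.2 hA)] at hnn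
    simpa using hnn
  · have e1 := Finset.insert_eq_of_mem (hmem1.2 hA)
    have e2 := Finset.erase_eq_of_notMem (mt hmem2.1 hB)
    rw [hers hZ hB, hins hW hA] at hb2
    have := arith (hw (W.erase e)) (hw (insert e W)) (by rwa [e1, e2]) hb2
    rw [hers hZ hB]
    calc _ = weight p q A * weight p q B * (f (insert e Z) - f (Z.erase e)) ^ 2 := by
          rw [e1]; ring
      _ ≤ _ := mul_le_mul_of_nonneg_right this (sq_nonneg _)
      _ = _ := by ring
  · have e1 := Finset.erase_eq_of_notMem (mt hmem1.1 hA)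
    have e2 := Finset.insert_eq_of_mem (hmem2.2 hB)
    rw [hins hZ hB, hers hW hA] at hb2
    have := arith (hw (W.erase e)) (hw (insert e W)) hb2 (by rwa [e1, e2])
    rw [hins hZ hB]
    calc _ = weight p q A * weight p q B * (f (insert e Z) - f (Z.erase e)) ^ 2 := by
          rw [e1]
      _ ≤ _ := mul_le_mul_of_nonneg_right this (sq_nonneg _)
      _ = _ := by ring
  · rw [hers hZ hB, Finset.erase_eq_of_notMem (mt hmem1.1 hA), sub_self]
    rw [Finset.erase_eq_of_notMem (mt hmem1.1 hA)] at hnn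
    simpa using hnn

variable [Fintype G.edgeSet]

/-- Reindexing pairs of states by the current and the complementary state. -/
theorem sum_mix (L : Finset G.edgeSet) (H : Finset G.edgeSet → Finset G.edgeSet → ℝ) :
    ∑ A, ∑ B, H (mix L A B) (mix L B A) = ∑ A, ∑ B, H A B := by
  have hinv : Function.Involutive fun s : Finset G.edgeSet × Finset G.edgeSet =>
      (mix L s.1 s.2, mix L s.2 s.1) := fun s => by simp [mix_mix]
  have := Equiv.sum_comp hinv.toPerm fun s => H s.1 s.2
  rw [Fintype.sum_prod_type, Fintype.sum_prod_type] at this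
  exact this

/-- The bound on a step depends on `(A, B)` only through the current and complementary states, which
run over all pairs, so the double sum factorises. The 4 arises because each of the two factors meets
every pair `A`, `insert e A` twice. -/
theorem sum_step_le [Finite V] [NeZero q] (hp0 : 0 < p) (hp1 : p < 1) {ℓ : ℕ}
    {L : Finset G.edgeSet} {e : G.edgeSet} (he : e ∉ L) (hL : (boundary L).ncard ≤ ℓ)
    (hL' : (boundary (insert e L)).ncard ≤ ℓ) (f : Finset G.edgeSet → ℝ) :
    ∑ A, ∑ B, weight p q A * weight p q B *
        (f (mix (insert e L) A B) - f (mix L A B)) ^ 2 ≤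
      4 * (q : ℝ) ^ (ℓ + 1) * (∑ A : Finset G.edgeSet, weight p q A) *
        ∑ A with e ∉ A, (1 - p) * weight p q (insert e A) * (f (insert e A) - f A) ^ 2 := by
  refine (Finset.sum_le_sum fun A _ => Finset.sum_le_sum fun B _ =>
    step_le hp0 hp1 he hL hL' f rfl rfl).trans ?_
  rw [sum_mix L fun Z W => (q : ℝ) ^ (ℓ + 1) * ((1 - p) * weight p q (insert e Z) *
        (f (insert e Z) - f (Z.erase e)) ^ 2 *
        (weight p q (insert e W) + weight p q (W.erase e)))]
  simp only [← Finset.mul_sum, ← Finset.sum_mul]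
  have h1 : ∑ Z, (1 - p) * weight p q (insert e Z) * (f (insert e Z) - f (Z.erase e)) ^ 2 =
      2 * ∑ A with e ∉ A, (1 - p) * weight p q (insert e A) * (f (insert e A) - f A) ^ 2 := by
    rw [sum_eq_sum_notMem e, Finset.mul_sum]
    refine Finset.sum_congr rfl fun A hA => ?_
    simp only [Finset.mem_filter, Finset.mem_univ, true_and] at hA
    rw [Finset.insert_idem, Finset.erase_insert hA, Finset.erase_eq_of_notMem hA]
    ring
  have h2 : ∑ W, (weight p q (insert e W) + weight p q (W.erase e)) =
      2 * ∑ A : Finset G.edgeSet, weight p q A := by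
    rw [sum_eq_sum_notMem e, sum_eq_sum_notMem e (weight p q), Finset.mul_sum]
    refine Finset.sum_congr rfl fun A hA => ?_
    simp only [Finset.mem_filter, Finset.mem_univ, true_and] at hA
    rw [Finset.insert_idem, Finset.erase_insert hA, Finset.erase_eq_of_notMem hA]
    ring
  rw [h1, h2]
  exact le_of_eq (by ring)

variable (G) in
/-- The set of the first `k` edges in the ordering `o`. -/
noncomputable def edgePrefix (o : Fin (Fintype.card G.edgeSet) ≃ G.edgeSet) (k : ℕ) :
    Finset G.edgeSet := Finset.univ.filter fun a => (o.symm a : ℕ) < k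

theorem edgePrefix_zero (o : Fin (Fintype.card G.edgeSet) ≃ G.edgeSet) :
    edgePrefix G o 0 = ∅ := by
  simp [edgePrefix]

theorem edgePrefix_card (o : Fin (Fintype.card G.edgeSet) ≃ G.edgeSet) :
    edgePrefix G o (Fintype.card G.edgeSet) = Finset.univ :=
  Finset.filter_true_of_mem fun a _ => (o.symm a).isLt

theorem notMem_edgePrefix (o : Fin (Fintype.card G.edgeSet) ≃ G.edgeSet)
    (i : Fin (Fintype.card G.edgeSet)) : o i ∉ edgePrefix G o i := by
  simp [edgePrefix]

theorem edgePrefix_succ (o : Fin (Fintype.card G.edgeSet) ≃ G.edgeSet)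
    (i : Fin (Fintype.card G.edgeSet)) :
    edgePrefix G o (i + 1) = insert (o i) (edgePrefix G o i) := by
  ext a
  simp only [edgePrefix, Finset.mem_filter, Finset.mem_univ, true_and, Finset.mem_insert,
    Nat.lt_succ_iff_lt_or_eq, ← Equiv.symm_apply_eq, Fin.ext_iff]
  tauto

theorem exists_order_of_linearWidth_le [Finite V] {ℓ : ℕ} (h : linearWidth G ≤ ℓ) :
    ∃ o : Fin (Fintype.card G.edgeSet) ≃ G.edgeSet,
      ∀ k ≤ Fintype.card G.edgeSet, (boundary (edgePrefix G o k)).ncard ≤ ℓ := by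
  have hne : {ℓ : ℕ | ∃ e : Fin (Fintype.card G.edgeSet) ≃ G.edgeSet,
    ∀ i, {v : V | (∃ j, j ≤ i ∧ v ∈ (e j : Sym2 V)) ∧
      ∃ j, i < j ∧ v ∈ (e j : Sym2 V)}.ncard ≤ ℓ}.Nonempty :=
    -- Any order works with the bound |V|, so the infimum is attained.
    ⟨Nat.card V, (Fintype.equivFin _).symm, fun i => Set.ncard_le_card _⟩
  obtain ⟨o, ho⟩ := Nat.sInf_mem hne
  refine ⟨o, fun k hk => ?_⟩
  -- A prefix of length `k + 1` is the cut after index `k` in `linearWidth`; the empty prefix has no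
  -- such index, but its boundary is empty.
  rcases k with _ | k
  · have : boundary (edgePrefix G o 0) = ∅ := by
      ext v; simp [boundary, edgePrefix_zero]
    simp [this]
  · refine le_trans (le_of_eq ?_) ((ho ⟨k, hk⟩).trans h)
    congr 1
    ext v
    simp only [boundary, Set.mem_ofPred_eq, o.surjective.exists, edgePrefix, Finset.mem_filter,
      Finset.mem_univ, true_and, Equiv.symm_apply_apply, Fin.le_def, Fin.lt_def, not_le,
      Nat.lt_succ_iff]

/-- `f B - f A` telescopes along the path, and Cauchy-Schwarz over its steps costs the factor |E|.
-/
theorem sum_sum_weight_sq_le [Finite V] [NeZero q] (hp0 : 0 < p) (hp1 : p < 1) {ℓ : ℕ}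
    (h : linearWidth G ≤ ℓ) (f : Finset G.edgeSet → ℝ) :
    ∑ A, ∑ B, weight p q A * weight p q B * (f B - f A) ^ 2 ≤
      Fintype.card G.edgeSet * (4 * (q : ℝ) ^ (ℓ + 1) *
        (∑ A : Finset G.edgeSet, weight p q A) * ∑ e : G.edgeSet,
          ∑ A with e ∉ A, (1 - p) * weight p q (insert e A) * (f (insert e A) - f A) ^ 2) := by
  obtain ⟨o, ho⟩ := exists_order_of_linearWidth_le h
  have hw := weight_pos (G := G) (q := q) hp0 hp1 (Nat.pos_of_neZero q)
  have hstep : ∀ A B : Finset G.edgeSet, weight p q A * weight p q B * (f B - f A) ^ 2 ≤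
      Fintype.card G.edgeSet * ∑ i : Fin (Fintype.card G.edgeSet), weight p q A * weight p q B *
        (f (mix (insert (o i) (edgePrefix G o i)) A B) - f (mix (edgePrefix G o i) A B)) ^ 2 := by
    intro A B
    have h1 := Finset.sum_range_sub (fun k => f (mix (edgePrefix G o k) A B))
      (Fintype.card G.edgeSet)
    rw [edgePrefix_card, edgePrefix_zero, mix_univ, mix_empty, ← Fin.sum_univ_eq_sum_range
      (fun k => f (mix (edgePrefix G o (k + 1)) A B) - f (mix (edgePrefix G o k) A B))] at h1
    have h2 := sq_sum_le_card_mul_sum_sq (s := (Finset.univ : Finset (Fin (Fintype.card G.edgeSet))))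
      (f := fun i : Fin (Fintype.card G.edgeSet) =>
        f (mix (edgePrefix G o (i + 1)) A B) - f (mix (edgePrefix G o i) A B))
    rw [h1, Finset.card_univ, Fintype.card_fin] at h2
    simp only [edgePrefix_succ] at h2
    rw [← Finset.mul_sum]
    refine (mul_le_mul_of_nonneg_left h2 (mul_pos (hw A) (hw B)).le).trans (le_of_eq ?_)
    ring
  refine (Finset.sum_le_sum fun A _ => Finset.sum_le_sum fun B _ => hstep A B).trans ?_
  have hcomm : ∀ (c : ℝ) (T : Finset G.edgeSet → Finset G.edgeSet →
      Fin (Fintype.card G.edgeSet) → ℝ),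
      ∑ A, ∑ B, c * ∑ i, T A B i = c * ∑ i, ∑ A, ∑ B, T A B i := by
    intro c T
    simp only [← Finset.mul_sum]
    rw [Finset.sum_congr rfl fun A _ => Finset.sum_comm, Finset.sum_comm]
  rw [hcomm]
  refine mul_le_mul_of_nonneg_left ?_ (Nat.cast_nonneg _)
  rw [← Equiv.sum_comp o, Finset.mul_sum]
  refine Finset.sum_le_sum fun i _ => ?_
  refine sum_step_le hp0 hp1 (notMem_edgePrefix o i) (ho i i.2.le) ?_ f
  rw [← edgePrefix_succ]
  exact ho (i + 1) i.2

/-- For mean zero the double sum is twice the total weight times the squared norm, so the norm is at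
most 2|E|q^(ℓ+1) times the sum of the edge Dirichlet forms. The chain's own Dirichlet form is that
sum divided by 2|E|, hence 4|E|²q^(ℓ+1). -/
theorem poincareBound_singleBond [Fintype V] [NeZero q] [Nonempty G.edgeSet] (hp0 : 0 < p)
    (hp1 : p < 1) {ℓ : ℕ} (h : linearWidth G ≤ ℓ) :
    MarkovChain.PoincareBound (singleBond G p q) (weight p q)
      (1 - (4 * (Fintype.card G.edgeSet : ℝ) ^ 2 * (q : ℝ) ^ (ℓ + 1))⁻¹) := by
  intro f hf
  have hw := weight_pos (G := G) (q := q) hp0 hp1 (Nat.pos_of_neZero q)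
  have hm : (0 : ℝ) < Fintype.card G.edgeSet := by exact_mod_cast Fintype.card_pos
  have hq : (0 : ℝ) < q := by exact_mod_cast Nat.pos_of_neZero q
  have h1 := sum_sum_weight_sq_le (q := q) hp0 hp1 h f
  have hW : 0 < ∑ A : Finset G.edgeSet, weight p q A :=
    Finset.sum_pos (fun A _ => hw A) Finset.univ_nonempty
  have h2 : ∑ A, ∑ B, weight p q A * weight p q B * (f B - f A) ^ 2 =
      2 * (∑ A : Finset G.edgeSet, weight p q A) * ∑ A, weight p q A * f A ^ 2 -
        2 * (∑ A, weight p q A * f A) ^ 2 := by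
    have e : ∀ A B, weight p q A * weight p q B * (f B - f A) ^ 2 =
        weight p q A * (weight p q B * f B ^ 2) + weight p q A * f A ^ 2 * weight p q B -
          2 * (weight p q A * f A) * (weight p q B * f B) := fun A B => by ring
    simp only [e, Finset.sum_sub_distrib, Finset.sum_add_distrib, ← Finset.mul_sum,
      ← Finset.sum_mul]
    ring
  rw [h2, hf] at h1
  have h3 := singleBond_dirichlet (q := q) hp1 f
  set D := ∑ e : G.edgeSet, ∑ A with e ∉ A,
    (1 - p) * weight p q (insert e A) * (f (insert e A) - f A) ^ 2
  set F := ∑ A, weight p q A * f A ^ 2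
  set W := ∑ A : Finset G.edgeSet, weight p q A
  set m : ℝ := (Fintype.card G.edgeSet : ℝ)
  have h4 : F ≤ 2 * m * (q : ℝ) ^ (ℓ + 1) * D := by
    have : (2 * W) * F ≤ (2 * W) * (2 * m * (q : ℝ) ^ (ℓ + 1) * D) := by linarith
    exact le_of_mul_le_mul_left this (by positivity)
  have h5 : (4 * m ^ 2 * (q : ℝ) ^ (ℓ + 1))⁻¹ * F ≤ 1 / (2 * m) * D := by
    rw [inv_mul_le_iff₀ (by positivity)]
    refine h4.trans (le_of_eq ?_)
    field_simp
    ring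
  linarith

end CanonicalPaths

end RandomCluster

namespace RandomCluster

/-! ### From the Poincaré inequality to mixing times -/

section Mixing

open Classical

variable {V : Type*} {G : SimpleGraph V} {p : ℝ} {q : ℕ}

/-- A bound for the change of the weight, in both directions, when an edge is added. -/
noncomputable def weightRatio (p : ℝ) (q : ℕ) : ℝ := p / (1 - p) + q * (1 - p) / p + 1

theorem one_le_weightRatio (hp0 : 0 < p) (hp1 : p < 1) : 1 ≤ weightRatio p q := by
  have : 0 < 1 - p := by linarith
  have h1 : 0 ≤ p / (1 - p) := by positivity
  have h2 : 0 ≤ q * (1 - p) / p := by positivity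
  unfold weightRatio
  linarith

theorem weight_insert_bounds [Finite V] [NeZero q] (hp0 : 0 < p) (hp1 : p < 1)
    {A : Finset G.edgeSet} {e : G.edgeSet} (he : e ∉ A) :
    weight p q (insert e A) ≤ weightRatio p q * weight p q A ∧
      weight p q A ≤ weightRatio p q * weight p q (insert e A) := by
  have hp : 0 < 1 - p := by linarith
  have hA := weight_pos (q := q) hp0 hp1 (Nat.pos_of_neZero q) A
  have hB := weight_pos (q := q) hp0 hp1 (Nat.pos_of_neZero q) (insert e A)
  have h1 := weight_mul_updateProb (q := q) hp1 he
  have h2 := mul_le_mul_of_nonneg_left (updateProb_le (q := q) hp0 A e) hA.le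
  have h3 := weight_erase_le (q := q) hp0 hp1 A e
  rw [Finset.erase_eq_of_notMem he] at h3
  have h4 : weight p q (insert e A) ≤ p / (1 - p) * weight p q A := by
    rw [div_mul_eq_mul_div, le_div_iff₀ hp]
    linarith
  have h5 : weight p q A ≤ q * (1 - p) / p * weight p q (insert e A) := by
    rw [div_mul_eq_mul_div, le_div_iff₀ hp0]
    linarith
  have h6 : 0 ≤ p / (1 - p) := by positivity
  have h7 : 0 ≤ q * (1 - p) / p := by positivity
  unfold weightRatio
  constructor
  · refine h4.trans (mul_le_mul_of_nonneg_right ?_ hA.le)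
    linarith
  · refine h5.trans (mul_le_mul_of_nonneg_right ?_ hB.le)
    linarith

theorem weight_empty_bounds [Finite V] [NeZero q] (hp0 : 0 < p) (hp1 : p < 1)
    (A : Finset G.edgeSet) :
    weight p q A ≤ weightRatio p q ^ A.card * weight p q (∅ : Finset G.edgeSet) ∧
      weight p q (∅ : Finset G.edgeSet) ≤ weightRatio p q ^ A.card * weight p q A := by
  have hc : 0 ≤ weightRatio p q := zero_le_one.trans (one_le_weightRatio hp0 hp1)
  induction A using Finset.induction_on with
  | empty => simp
  | insert e A he ih =>
    obtain ⟨h1, h2⟩ := weight_insert_bounds (q := q) hp0 hp1 he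
    rw [Finset.card_insert_of_notMem he, pow_succ]
    constructor
    · refine h1.trans ((mul_le_mul_of_nonneg_left ih.1 hc).trans (le_of_eq ?_))
      ring
    · refine ih.2.trans ((mul_le_mul_of_nonneg_left h2 (pow_nonneg hc _)).trans (le_of_eq ?_))
      ring

variable [Fintype G.edgeSet]

/-- Any two states are compared through the empty set, which squares the ratio; the 2 counts the
states. So 1/μ(A) is at most exponential in |E|. -/
theorem sum_weight_div_le [Finite V] [NeZero q] (hp0 : 0 < p) (hp1 : p < 1)
    (A : Finset G.edgeSet) :
    (∑ B : Finset G.edgeSet, weight p q B) / weight p q A ≤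
      (2 * weightRatio p q ^ 2) ^ Fintype.card G.edgeSet := by
  have hc := one_le_weightRatio (q := q) hp0 hp1
  have hc0 : 0 ≤ weightRatio p q := zero_le_one.trans hc
  have hA := weight_pos (q := q) hp0 hp1 (Nat.pos_of_neZero q) A
  rw [div_le_iff₀ hA]
  have hpow : ∀ B : Finset G.edgeSet,
      weightRatio p q ^ B.card ≤ weightRatio p q ^ Fintype.card G.edgeSet :=
    fun B => pow_le_pow_right₀ hc (Finset.card_le_univ B)
  have h1 : ∀ B ∈ (Finset.univ : Finset (Finset G.edgeSet)), weight p q B ≤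
      (weightRatio p q ^ 2) ^ Fintype.card G.edgeSet * weight p q A := by
    intro B _
    have h0 := weight_pos (G := G) (q := q) hp0 hp1 (Nat.pos_of_neZero q) ∅
    calc weight p q B ≤ weightRatio p q ^ B.card * weight p q (∅ : Finset G.edgeSet) :=
          (weight_empty_bounds hp0 hp1 B).1
      _ ≤ weightRatio p q ^ Fintype.card G.edgeSet *
          (weightRatio p q ^ Fintype.card G.edgeSet * weight p q A) := by
          refine mul_le_mul (hpow B) ((weight_empty_bounds hp0 hp1 A).2.trans ?_) h0.le
            (pow_nonneg hc0 _)
          exact mul_le_mul_of_nonneg_right (hpow A) hA.le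
      _ = _ := by rw [← pow_mul]; ring
  refine (Finset.sum_le_card_nsmul _ _ _ h1).trans (le_of_eq ?_)
  rw [Finset.card_univ, Fintype.card_finset, nsmul_eq_mul, mul_pow]
  push_cast
  ring

/-- The constant in the bound for the mixing times. -/
noncomputable def mixingConstant (p : ℝ) (q ℓ : ℕ) : ℝ :=
  4 * (q : ℝ) ^ (ℓ + 1) * (2 + Real.log (2 * weightRatio p q ^ 2)) / Real.log 2 ^ 3

/-- The exponent 3 is two powers of |E| from the relaxation time and one from log(1/μ(A)); `Real.log
2 ^ 3` in the constant converts |E| into log|Ω|. -/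
theorem exists_mixingTime_le [Finite V] [NeZero q] [Nonempty G.edgeSet] (hp0 : 0 < p)
    (hp1 : p < 1) (ℓ : ℕ) [DecidableEq (Finset G.edgeSet)]
    {P : Matrix (Finset G.edgeSet) (Finset G.edgeSet) ℝ}
    (hP : MarkovChain.IsReversiblePSD P (weight p q))
    (hβ : MarkovChain.PoincareBound P (weight p q)
      (1 - (4 * (Fintype.card G.edgeSet : ℝ) ^ 2 * (q : ℝ) ^ (ℓ + 1))⁻¹)) :
    ∃ t : ℕ, MarkovChain.mixingTime P (measure G p q) = (t : ℕ∞) ∧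
      (t : ℝ) ≤ mixingConstant p q ℓ *
        Real.log (Fintype.card (Finset G.edgeSet)) ^ ((3 : ℕ) : ℝ) := by
  have hm1 : (1 : ℝ) ≤ Fintype.card G.edgeSet := by exact_mod_cast Fintype.card_pos
  have hq : (1 : ℝ) ≤ q := by exact_mod_cast NeZero.one_le
  have hQ1 : (1 : ℝ) ≤ (q : ℝ) ^ (ℓ + 1) := one_le_pow₀ hq
  have hc := one_le_weightRatio (q := q) hp0 hp1
  set R := 2 * weightRatio p q ^ 2 with hRdef
  have hR : 1 ≤ R := by nlinarith
  have hlogR : 0 ≤ Real.log R := Real.log_nonneg hR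
  have hlog : Real.log (Fintype.card (Finset G.edgeSet)) =
      (Fintype.card G.edgeSet : ℝ) * Real.log 2 := by
    rw [Fintype.card_finset]; push_cast; rw [Real.log_pow]
  rw [hlog, Real.rpow_natCast]
  have hsqrt : ∀ A : Finset G.edgeSet,
      √((∑ B : Finset G.edgeSet, weight p q B) / weight p q A) ≤
        Real.exp ((Fintype.card G.edgeSet : ℝ) * Real.log R) := by
    intro A
    have h1 : (1 : ℝ) ≤ R ^ Fintype.card G.edgeSet := one_le_pow₀ hR
    rw [Real.exp_nat_mul, Real.exp_log (by linarith)]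
    refine (Real.sqrt_le_sqrt (sum_weight_div_le hp0 hp1 A)).trans ?_
    rw [Real.sqrt_le_left (by linarith)]
    nlinarith
  set m : ℝ := (Fintype.card G.edgeSet : ℝ)
  set D : ℝ := 4 * m ^ 2 * (q : ℝ) ^ (ℓ + 1) with hD
  have hD1 : 1 ≤ D := by nlinarith [one_le_pow₀ hm1 (n := 2)]
  have hβ0 : 0 ≤ 1 - D⁻¹ := sub_nonneg.2 (inv_le_one_of_one_le₀ hD1)
  -- Since `1 - D⁻¹ ≤ exp (-D⁻¹)`, this many steps beat the initial factor exp(m log R) and leave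
  -- 1/e.
  set t := ⌈D * (1 + m * Real.log R)⌉₊ with ht
  have hmix : ∀ A, ∑ B, |(P ^ t) A B - measure G p q B| ≤ 1 / Real.exp 1 := by
    intro A
    refine (hP.sum_abs_pow_sub_le hβ hβ0 t A).trans ?_
    have h1 : (1 - D⁻¹) ^ t ≤ Real.exp (-(1 + m * Real.log R)) := by
      have h2 : 1 - D⁻¹ ≤ Real.exp (-D⁻¹) := by
        have := Real.add_one_le_exp (-D⁻¹)
        linarith
      refine (pow_le_pow_left₀ hβ0 h2 t).trans ?_
      rw [← Real.exp_nat_mul, Real.exp_le_exp, mul_neg, neg_le_neg_iff, ← div_eq_mul_inv,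
        le_div_iff₀ (by linarith), mul_comm]
      exact Nat.le_ceil _
    refine (mul_le_mul h1 (hsqrt A) (Real.sqrt_nonneg _) (Real.exp_pos _).le).trans (le_of_eq ?_)
    rw [← Real.exp_add, one_div, ← Real.exp_neg]
    congr 1
    ring
  obtain ⟨s, hs, hst⟩ := MarkovChain.exists_mixingTime_eq hmix
  refine ⟨s, hs, ?_⟩
  have h1 : (s : ℝ) ≤ t := by exact_mod_cast hst
  have h2 : (t : ℝ) < D * (1 + m * Real.log R) + 1 := Nat.ceil_lt_add_one (by positivity)
  have h3 : D * (1 + m * Real.log R) + 1 ≤ D * m * (2 + Real.log R) := by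
    have h4 : D ≤ D * m := le_mul_of_one_le_right (by linarith) hm1
    linarith [show D * m * (2 + Real.log R) = D * m + D * m + D * (m * Real.log R) by ring,
      show D * (1 + m * Real.log R) = D + D * (m * Real.log R) by ring]
  refine (h1.trans (h2.le.trans h3)).trans (le_of_eq ?_)
  have hl2 : Real.log 2 ≠ 0 := (Real.log_pos one_lt_two).ne'
  rw [mixingConstant, ← hRdef, hD]
  field_simp

end Mixing

end RandomCluster

/-! ### Conclusion -/

theorem mainTheorem4 (p : ℝ) (hp0 : 0 < p) (hp1 : p < 1) (q : ℕ) (hq : 1 ≤ q) (ℓ : ℕ) :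
    (∀ (V : Type*) [Fintype V] [DecidableEq V] (G : SimpleGraph V) [DecidableRel G.Adj],
      G.edgeSet.Nonempty → RandomCluster.linearWidth G ≤ ℓ →
        0 < MarkovChain.spectralGap (RandomCluster.swendsenWang G p q) ∧
        0 < MarkovChain.spectralGap (RandomCluster.singleBond G p q) ∧
        (MarkovChain.spectralGap (RandomCluster.swendsenWang G p q))⁻¹ ≤
          (MarkovChain.spectralGap (RandomCluster.singleBond G p q))⁻¹ ∧
        (MarkovChain.spectralGap (RandomCluster.singleBond G p q))⁻¹ ≤
          4 * (Fintype.card G.edgeSet : ℝ) ^ 2 * (q : ℝ) ^ (ℓ + 1)) ∧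
    (∀ (ι : Type*) (V : ι → Type*) [∀ i, Fintype (V i)] [∀ i, DecidableEq (V i)]
      (G : ∀ i, SimpleGraph (V i)) [∀ i, DecidableRel (G i).Adj],
      (∀ i, (G i).edgeSet.Nonempty) → (∀ i, RandomCluster.linearWidth (G i) ≤ ℓ) →
        MarkovChain.RapidlyMixing (fun i => RandomCluster.swendsenWang (G i) p q)
          (fun i => RandomCluster.measure (G i) p q) ∧
        MarkovChain.RapidlyMixing (fun i => RandomCluster.singleBond (G i) p q)
          (fun i => RandomCluster.measure (G i) p q)) := by
  have : NeZero q := ⟨by omega⟩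
  refine ⟨?_, ?_⟩
  · intro V _ _ G _ hne hℓ
    have : Nonempty G.edgeSet := hne.to_subtype
    have hm : (1 : ℝ) ≤ Fintype.card G.edgeSet := by exact_mod_cast Fintype.card_pos
    have hQ : (1 : ℝ) ≤ (q : ℝ) ^ (ℓ + 1) := one_le_pow₀ (by exact_mod_cast hq)
    have hD : 1 ≤ 4 * (Fintype.card G.edgeSet : ℝ) ^ 2 * (q : ℝ) ^ (ℓ + 1) := by
      nlinarith [one_le_pow₀ hm (n := 2)]
    have hSB := RandomCluster.isReversiblePSD_singleBond (G := G) (q := q) hp0 hp1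
    have hSW := RandomCluster.isReversiblePSD_swendsenWang (G := G) (q := q) hp0 hp1
    have hβ := RandomCluster.poincareBound_singleBond (G := G) (q := q) hp0 hp1 hℓ
    have hDinv := inv_pos.2 (zero_lt_one.trans_le hD)
    have h1 := hSB.one_sub_le_spectralGap hβ (sub_nonneg.2 (inv_le_one_of_one_le₀ hD))
    have h2 := hSW.spectralGap_le_of_form_le hSB hβ (sub_lt_self _ hDinv)
      (RandomCluster.swendsenWang_form_le_singleBond_form hp0 hp1)
    rw [sub_sub_cancel] at h1
    have h3 := hDinv.trans_le h1
    exact ⟨h3.trans_le h2, h3, inv_anti₀ h3 h2, inv_le_of_inv_le₀ (by linarith) h1⟩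
  · intro ι V _ _ G _ hne hℓ
    refine ⟨⟨((3 : ℕ) : ℝ), RandomCluster.mixingConstant p q ℓ, fun i => ?_⟩,
      ⟨((3 : ℕ) : ℝ), RandomCluster.mixingConstant p q ℓ, fun i => ?_⟩⟩
    all_goals
      have : Nonempty (G i).edgeSet := (hne i).to_subtype
      have hβ := RandomCluster.poincareBound_singleBond (G := G i) (q := q) hp0 hp1 (hℓ i)
    -- Swendsen-Wang inherits the Poincaré bound of the single-bond chain by domination of forms.
    · exact RandomCluster.exists_mixingTime_le hp0 hp1 ℓ
        (RandomCluster.isReversiblePSD_swendsenWang hp0 hp1) fun f hf =>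
          (RandomCluster.swendsenWang_form_le_singleBond_form hp0 hp1 f).trans (hβ f hf)
    · exact RandomCluster.exists_mixingTime_le hp0 hp1 ℓ
        (RandomCluster.isReversiblePSD_singleBond hp0 hp1) hβ
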